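/- **Setting.** A *Tanner square complex* $T$ is a finite square complex with vertex set $V_X\sqcup V_Q\sqcup V_Z$ ($X$-checks, qubits, $Z$-checks), every square having a boundary cycle $(x,q,z,q')$ with $x\in V_X$, $q,q'\in V_Q$, $z\in V_Z$. Its code is $C(T):\ \mathbb F_2^{V_X}\xrightarrow{\delta^0}\mathbb F_2^{V_Q}\xrightarrow{\delta^1}\mathbb F_2^{V_Z}$, where $\delta^0,\delta^1$ are the adjacency maps; $B^2(C(T))=\operatorname{im}\delta^1$ is the space of syndromes and $|\cdot|$ is Hamming weight. Fix an odd integer $\ell\ge 3$. *Replacement.* In $\mathcal R_Z(T)$ each square of $T$ is replaced by a copy of $U_Z$: two $\ell\times\ell$ grids with coordinates $0\le a,b\le \ell$, where $z=(0,0)$, $q=(\ell,0)$, $q'=(0,\ell)$, $x=(\ell,\ell)$, at heights $c=0$ and $c=2$, joined by a strip of thickness two (height $c=1$ in the middle) over the lines $a=\ell-1$ and $b=\ell-1$. A vertex is a $Z$-check, a qubit or an $X$-check if it has $0$, $1$ or $2$ odd coordinates. The copies are glued along the edges and corners of the squares of $T$. $\mathcal R_X$ is the same operation with the roles of $X$ and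 $Z$ exchanged. Let $T_{(0)}$ be the complex of the $[\![5,1,2]\!]$ surface code, $T_{(j+1)}=\mathcal R_X(T_{(j)})$ for $j$ even, $T_{(j+1)}=\mathcal R_Z(T_{(j)})$ for $j$ odd, and $C_{(j)}=C(T_{(j)})$. *Local complexes.* Let level $i$ be an $\mathcal R_Z$ level, i.e. $T_{(i)}=\mathcal R_Z(T_{(i-1)})$ with $i\ge 2$ even. The vertices of $T_{(i)}$ are partitioned into local pieces $Y_v$, $v\in T_{(i-1)}(0)$: $Y_z$ consists of the vertices with $a,b\le \ell-1$ in the squares containing $z$; $Y_q$ of the vertices on the edges joining $q$ to $X$-checks, without the end at the $X$-check; $Y_x$ of the two copies of $x$. Correspondingly $C_{(i)}=\bigoplus_v C_v$ as graded spaces and $\delta=\delta_{\mathrm{loc}}+g$, where $\delta_{\mathrm{loc}}=\bigoplus_v\delta_v$ is the part inside the local pieces. *The map $\mathcal F_{\mathcal R_Z}$.* Choose for every $v$ a homotopy $h_v$ of degree $-1$ on $(C_v,\delta_v)$ with $\delta_v h_v\delta_v=\delta_v$, $h_v\delta_v h_v=h_v$, $h_v^2=0$ (a contraction of $C_v$ onto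 its cohomology), and put $h=\bigoplus_v h_v$. Let $\iota: C_{(i-1)}\to C_{(i)}$ send a basis element $v$ to the representative $(1+h\delta_{\mathrm{loc}}+\delta_{\mathrm{loc}}h)[v,0]$ of the local cohomology class of the copy $[v,0]$ of $v$ at height $0$. Then $\mathcal F_{\mathcal R_Z}=(1+hg+(hg)^2)\,\iota: C_{(i-1)}\to C_{(i)}$ is the map given by homological perturbation. *Local computability.* Direct the edges of $T_{(i-1)}$ as $x\to q\to z$, let $\mathrm{dist}(v',v)$ be the directed distance ($\infty$ if there is no directed path), and let $\xi_v(k)=\sum_{v':\,\mathrm{dist}(v',v)\le k}\sigma|_{Y_{v'}}$. A map $\sigma\mapsto(\sigma',f)$ is *locally computable* if $f=\sum_{v}f_v$ with $f_v=f|_{Y_v}$ a function of $\xi_v(1)$ only, for every $v\in T_{(i-1)}(0)$, and $\sigma'|_z$ is a function of $\xi_z(2)$ only, for every $z\in V_{Z,(i-1)}$. **Theorem.** For every odd $\ell\ge3$, every $\mathcal R_Z$ level $i$ and every choice of the contractions $h_v$, there is a locally computable coarse-graining map $$B^2(C_{(i)})\to B^2(C_{(i-1)})\times C^1_{(i)},\qquad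 \sigma\mapsto(\sigma',f),$$ such that for every $\sigma\in B^2(C_{(i)})$ $$\sigma=\delta^1 f+\mathcal F_{\mathcal R_Z}(\sigma'),\qquad |\sigma'|\le|\sigma|,$$ and $\sigma'|_z=\sum_{p\in Y_z}\sigma|_p$ in $\mathbb F_2$, the sum over the $Z$-checks $p$ of $Y_z$, for every $z\in V_{Z,(i-1)}$. -/

import Mathlib

noncomputable section

namespace CoarseGraining

/-- The field with two elements. -/
abbrev F2 : Type := ZMod 2

/-! ### Tanner square complexes and their codes -/

/-- A finite square complex whose vertices are coloured by `X`-checks, qubits and `Z`-checks.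
Every edge lies on a square; the square `f` has the boundary cycle
`(xOf f, qOf f false, zOf f, qOf f true)`. -/
structure TannerComplex where
  X : Type
  Q : Type
  Z : Type
  F : Type
  finX : Fintype X
  finQ : Fintype Q
  finZ : Fintype Z
  finF : Fintype F
  xOf : F → X
  qOf : F → Bool → Q
  zOf : F → Z

namespace TannerComplex

attribute [instance] finX finQ finZ finF

variable (T : TannerComplex)

/-- The `X`-check `x` and the qubit `q` are joined by an edge. -/
def XQ (x : T.X) (q : T.Q) : Prop := ∃ (f : T.F) (s : Bool), T.xOf f = x ∧ T.qOf f s = q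

/-- The qubit `q` and the `Z`-check `z` are joined by an edge. -/
def QZ (q : T.Q) (z : T.Z) : Prop := ∃ (f : T.F) (s : Bool), T.qOf f s = q ∧ T.zOf f = z

theorem xq_self (f : T.F) (s : Bool) : T.XQ (T.xOf f) (T.qOf f s) := ⟨f, s, rfl, rfl⟩

theorem qz_self (f : T.F) (s : Bool) : T.QZ (T.qOf f s) (T.zOf f) := ⟨f, s, rfl, rfl⟩

/-- All vertices of the complex. -/
abbrev V : Type := T.X ⊕ T.Q ⊕ T.Z

/-- The cochain spaces `C⁰ → C¹ → C²` of the code of `T`. -/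
abbrev C0 : Type := T.X → F2
abbrev C1 : Type := T.Q → F2
abbrev C2 : Type := T.Z → F2

open Classical in
/-- The matrix of `δ⁰ = H_xᵀ`. -/
def mat0 : Matrix T.Q T.X F2 := Matrix.of fun q x => if T.XQ x q then 1 else 0

open Classical in
/-- The matrix of `δ¹ = H_z`. -/
def mat1 : Matrix T.Z T.Q F2 := Matrix.of fun z q => if T.QZ q z then 1 else 0

def δ0 : T.C0 →ₗ[F2] T.C1 := T.mat0.mulVecLin

def δ1 : T.C1 →ₗ[F2] T.C2 := T.mat1.mulVecLin

/-- The syndromes `B² = im δ¹`. -/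
def B2 : Submodule F2 T.C2 := LinearMap.range T.δ1

/-- Exchange the roles of `X` and `Z`. -/
def dual : TannerComplex where
  X := T.Z
  Q := T.Q
  Z := T.X
  F := T.F
  finX := T.finZ
  finQ := T.finQ
  finZ := T.finX
  finF := T.finF
  xOf := T.zOf
  qOf := T.qOf
  zOf := T.xOf

/-- The directed edges `x → q → z` of the 1-skeleton. -/
def Arc : T.V → T.V → Prop
  | .inl x, .inr (.inl q) => T.XQ x q
  | .inr (.inl q), .inr (.inr z) => T.QZ q z
  | _, _ => False

/-- There is a directed path of length `n` from `u` to `v`. -/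
inductive DiPath : ℕ → T.V → T.V → Prop
  | nil (u : T.V) : DiPath 0 u u
  | cons {n : ℕ} {u v w : T.V} : T.Arc u v → DiPath n v w → DiPath (n + 1) u w

/-- Directed distance: the least length of a directed path, `⊤` if there is none. -/
def dirDist (u v : T.V) : ℕ∞ := ⨅ (n : ℕ) (_ : T.DiPath n u v), (n : ℕ∞)

end TannerComplex

/-! ### The replacement `R_Z`

Let `ℓ = 2 m + 1`. A square `(z, q, x, q')` of `T` is subdivided into an `ℓ × ℓ` grid with
coordinates `0 ≤ a, b ≤ ℓ`, where `z = (0, 0)`, `q = (ℓ, 0)`, `q' = (0, ℓ)`, `x = (ℓ, ℓ)`. The complex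
`U_Z` consists of two copies of this grid, at heights `c = 0` and `c = 2`, joined by a strip of
thickness two along the lines `a = ℓ - 1` and `b = ℓ - 1`. A vertex `(a, b, c)` of `U_Z` is a
`Z`-check, a qubit or an `X`-check if it has zero, one or two odd coordinates. Copies of `U_Z`
are glued along the edges and corners of the squares of `T`. -/

section Replacement

variable (m : ℕ+) (T : TannerComplex)

/-- Grid points of the subdivision of `T`, listed by the open cell of `T` that contains them.
The positions lie strictly between `0` and `ℓ = 2 m + 1`. -/
inductive PlanePoint : Type
  /-- the corner `z` -/
  | atZ (z : T.Z)
  /-- on the edge `z q`, at distance `a` from `z` -/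
  | onZQ (z : T.Z) (q : T.Q) (h : T.QZ q z) (a : Set.Ioo 0 (2 * (m : ℕ) + 1))
  /-- the corner `q` -/
  | atQ (q : T.Q)
  /-- on the edge `q x`, at distance `b` from `q` -/
  | onQX (q : T.Q) (x : T.X) (h : T.XQ x q) (b : Set.Ioo 0 (2 * (m : ℕ) + 1))
  /-- the corner `x` -/
  | atX (x : T.X)
  /-- in the interior of the square `f` -/
  | inF (f : T.F) (a b : Set.Ioo 0 (2 * (m : ℕ) + 1))

namespace PlanePoint

variable {m T}

/-- The number of odd coordinates in the plane. -/
def odds : PlanePoint m T → ℕ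
  | atZ _ => 0
  | onZQ _ _ _ a => (a : ℕ) % 2
  | atQ _ => 1
  | onQX _ _ _ b => 1 + (b : ℕ) % 2
  | atX _ => 2
  | inF _ a b => (a : ℕ) % 2 + (b : ℕ) % 2

/-- The point lies on one of the lines `a = ℓ - 1`, `b = ℓ - 1` of a square. -/
def OnStrip : PlanePoint m T → Prop
  | onZQ _ _ _ a => (a : ℕ) = 2 * m
  | onQX _ _ _ b => (b : ℕ) = 2 * m
  | inF _ a b => (a : ℕ) = 2 * m ∨ (b : ℕ) = 2 * m
  | _ => False

/-- The vertex `v` of `T` whose local complex `Y_v` contains the point: `Y_z` is the part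
`a, b ≤ ℓ - 1` of the squares at `z`, `Y_q` is the part `b ≤ ℓ - 1` of the edges `q x`, and the
remaining points lie over `x`. -/
def owner : PlanePoint m T → T.V
  | atZ z => .inr (.inr z)
  | onZQ z _ _ _ => .inr (.inr z)
  | atQ q => .inr (.inl q)
  | onQX q _ _ _ => .inr (.inl q)
  | atX x => .inl x
  | inF f _ _ => .inr (.inr (T.zOf f))

theorem finite : Finite (PlanePoint m T) := by
  let I := Set.Ioo 0 (2 * (m : ℕ) + 1)
  let code : PlanePoint m T →
      T.Z ⊕ (T.Z × T.Q × I) ⊕ T.Q ⊕ (T.Q × T.X × I) ⊕ T.X ⊕ (T.F × I × I) := fun p =>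
    match p with
    | atZ z => .inl z
    | onZQ z q _ a => .inr (.inl (z, q, a))
    | atQ q => .inr (.inr (.inl q))
    | onQX q x _ b => .inr (.inr (.inr (.inl (q, x, b))))
    | atX x => .inr (.inr (.inr (.inr (.inl x))))
    | inF f a b => .inr (.inr (.inr (.inr (.inr (f, a, b)))))
  refine Finite.of_injective code ?_
  intro p p' h
  cases p <;> cases p' <;> simp_all [code]

end PlanePoint

/-- The grid point with coordinates `(a, b)`, `0 ≤ a, b ≤ ℓ`, of the square `f`; here `a` is measured
towards `qOf f false` and `b` towards `qOf f true`. (Larger values are treated as `ℓ`.) -/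
def pt (f : T.F) (a b : ℕ) : PlanePoint m T :=
  let z := T.zOf f
  let x := T.xOf f
  let q := T.qOf f false
  let q' := T.qOf f true
  if ha : a ∈ Set.Ioo 0 (2 * (m : ℕ) + 1) then
    if hb : b ∈ Set.Ioo 0 (2 * (m : ℕ) + 1) then .inF f ⟨a, ha⟩ ⟨b, hb⟩
    else if b = 0 then .onZQ z q (T.qz_self f false) ⟨a, ha⟩
    else .onQX q' x (T.xq_self f true) ⟨a, ha⟩
  else if a = 0 then
    if hb : b ∈ Set.Ioo 0 (2 * (m : ℕ) + 1) then .onZQ z q' (T.qz_self f true) ⟨b, hb⟩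
    else if b = 0 then .atZ z
    else .atQ q'
  else
    if hb : b ∈ Set.Ioo 0 (2 * (m : ℕ) + 1) then .onQX q x (T.xq_self f false) ⟨b, hb⟩
    else if b = 0 then .atQ q
    else .atX x

theorem odds_pt (f : T.F) (a b : ℕ) (ha : a ≤ 2 * m + 1) (hb : b ≤ 2 * m + 1) :
    (pt m T f a b).odds = a % 2 + b % 2 := by
  unfold pt
  simp only [Set.mem_Ioo]
  split_ifs <;> simp only [PlanePoint.odds] <;> omega

theorem onStrip_pt_left (f : T.F) (b : ℕ) : (pt m T f (2 * m) b).OnStrip := by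
  have := m.pos
  unfold pt
  simp only [Set.mem_Ioo]
  split_ifs <;> simp [PlanePoint.OnStrip] <;> omega

theorem onStrip_pt_right (f : T.F) (a : ℕ) : (pt m T f a (2 * m)).OnStrip := by
  have := m.pos
  unfold pt
  simp only [Set.mem_Ioo]
  split_ifs <;> simp [PlanePoint.OnStrip] <;> omega

/-- The vertices of the new complex: a grid point and a height `0`, `1` or `2`, where the height
`1` occurs on the strip only. -/
def Vertex : Type := {p : PlanePoint m T × Fin 3 // p.2 = 1 → p.1.OnStrip}

namespace Vertex

variable {m T}

/-- The number of odd coordinates. -/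
def odds (v : Vertex m T) : ℕ := v.1.1.odds + (v.1.2 : ℕ) % 2

/-- The vertex of `T` whose local complex contains `v`. -/
def owner (v : Vertex m T) : T.V := v.1.1.owner

instance : Finite (Vertex m T) :=
  have : Finite (PlanePoint m T) := PlanePoint.finite
  inferInstanceAs (Finite {p : PlanePoint m T × Fin 3 // p.2 = 1 → p.1.OnStrip})

end Vertex

/-- The even, respectively odd, element of `{j, j + 1}`. -/
def ev (j : ℕ) : ℕ := 2 * ((j + 1) / 2)
def od (j : ℕ) : ℕ := 2 * (j / 2) + 1

/-- The unit squares of `U_Z`. -/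
inductive UnitSquare : Type
  /-- the square `[i, i + 1] × [j, j + 1]` at height `2` if `top`, otherwise at height `0` -/
  | layer (top : Bool) (i j : Fin (2 * (m : ℕ) + 1))
  /-- the square `[j, j + 1] × [c, c + 1]`, with `c = 1` if `top` and otherwise `c = 0`, over the line
  `b = ℓ - 1` if `right`, otherwise over the line `a = ℓ - 1` -/
  | strip (right : Bool) (j : Fin (2 * (m : ℕ) + 1)) (top : Bool)

theorem UnitSquare.finite : Finite (UnitSquare m) := by
  let I := Fin (2 * (m : ℕ) + 1)
  let code : UnitSquare m → (Bool × I × I) ⊕ (Bool × I × Bool) := fun s =>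
    match s with
    | .layer t i j => .inl (t, i, j)
    | .strip r j t => .inr (r, j, t)
  refine Finite.of_injective code ?_
  intro p p' h
  cases p <;> cases p' <;> simp_all [code]

/-- Height `0` or `2`. -/
def outer (top : Bool) : Fin 3 := if top then 2 else 0

variable {m T}

/-- The vertex `(a, b)` in the bottom or top layer. -/
def layerVertex (f : T.F) (a b : ℕ) (top : Bool) : Vertex m T :=
  ⟨(pt m T f a b, outer top), fun h => absurd h (by cases top <;> simp [outer])⟩

/-- The vertex at position `j` and height `c` of the strip over `a = ℓ - 1` or `b = ℓ - 1`. -/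
def stripVertex (f : T.F) (right : Bool) (j : ℕ) (c : Fin 3) : Vertex m T :=
  ⟨(if right then pt m T f j (2 * m) else pt m T f (2 * m) j, c), fun _ => by
    cases right
    · exact onStrip_pt_left m T f j
    · exact onStrip_pt_right m T f j⟩

theorem odds_layerVertex (f : T.F) (a b : ℕ) (top : Bool) (ha : a ≤ 2 * m + 1)
    (hb : b ≤ 2 * m + 1) :
    (layerVertex f a b top : Vertex m T).odds = a % 2 + b % 2 := by
  cases top <;> simp [Vertex.odds, layerVertex, outer, odds_pt m T f a b ha hb]

theorem odds_stripVertex (f : T.F) (right : Bool) (j : ℕ) (c : Fin 3) (hj : j ≤ 2 * m + 1) :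
    (stripVertex f right j c : Vertex m T).odds = j % 2 + (c : ℕ) % 2 := by
  cases right
  · simp [Vertex.odds, stripVertex, odds_pt m T f (2 * m) j (by omega) hj]
  · simp [Vertex.odds, stripVertex, odds_pt m T f j (2 * m) hj (by omega)]

/-- The `Z`-corner of a unit square: all coordinates are even. -/
def zCorner (f : T.F) : UnitSquare m → {v : Vertex m T // v.odds = 0}
  | .layer t i j => ⟨layerVertex f (ev i) (ev j) t, by
      rw [odds_layerVertex] <;> simp only [ev] <;> omega⟩
  | .strip r j t => ⟨stripVertex f r (ev j) (outer t), by
      rw [odds_stripVertex] <;> cases t <;> simp [outer, ev] <;> omega⟩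

/-- The `X`-corner of a unit square: two coordinates are odd. -/
def xCorner (f : T.F) : UnitSquare m → {v : Vertex m T // v.odds = 2}
  | .layer t i j => ⟨layerVertex f (od i) (od j) t, by
      rw [odds_layerVertex] <;> simp only [od] <;> omega⟩
  | .strip r j _ => ⟨stripVertex f r (od j) 1, by
      rw [odds_stripVertex]
      · simp [od]
      · simp only [od]
        omega⟩

/-- The two qubit corners of a unit square: one coordinate is odd. -/
def qCorner (f : T.F) : UnitSquare m → Bool → {v : Vertex m T // v.odds = 1}
  | .layer t i j, false => ⟨layerVertex f (od i) (ev j) t, by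
      rw [odds_layerVertex] <;> simp only [ev, od] <;> omega⟩
  | .layer t i j, true => ⟨layerVertex f (ev i) (od j) t, by
      rw [odds_layerVertex] <;> simp only [ev, od] <;> omega⟩
  | .strip r j t, false => ⟨stripVertex f r (od j) (outer t), by
      rw [odds_stripVertex] <;> cases t <;> simp [outer, od] <;> omega⟩
  | .strip r j _, true => ⟨stripVertex f r (ev j) 1, by
      rw [odds_stripVertex]
      · simp [ev]
      · simp only [ev]
        omega⟩

variable (m T)

/-- The replacement `R_Z` at scale `ℓ = 2 m + 1`. The vertices owned by a vertex `v` of `T` are the cells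
of the local cell complex `Y_v`: two copies of the subdivided star of `v`, joined by a cylinder over
its outer boundary, with `k`-cells in cochain degree `2 - k` for `v` a `Z`-check, `1 - k` for `v` a
qubit and `0` for `v` an `X`-check, so that `C_v` is the dual of the cochain complex of `Y_v`. -/
def replaceZ : TannerComplex where
  X := {v : Vertex m T // v.odds = 2}
  Q := {v : Vertex m T // v.odds = 1}
  Z := {v : Vertex m T // v.odds = 0}
  F := T.F × UnitSquare m
  finX := Fintype.ofFinite _
  finQ := Fintype.ofFinite _
  finZ := Fintype.ofFinite _
  finF := have := UnitSquare.finite m; Fintype.ofFinite _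
  xOf s := xCorner s.1 s.2
  qOf s := qCorner s.1 s.2
  zOf s := zCorner s.1 s.2

/-- The replacement `R_X` at scale `ℓ = 2 m + 1`: the roles of `X` and `Z` are exchanged. -/
def replaceX : TannerComplex := (replaceZ m T.dual).dual

/-- The `[[5,1,2]]` surface code: two `X`-checks, two `Z`-checks, a central qubit `none` that meets all
checks, and for every pair of checks a qubit `some (x, z)` that meets just these two. -/
def baseComplex : TannerComplex where
  X := Bool
  Q := Option (Bool × Bool)
  Z := Bool
  F := Bool × Bool
  finX := inferInstance
  finQ := inferInstance
  finZ := inferInstance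
  finF := inferInstance
  xOf f := f.1
  qOf f s := if s then some f else none
  zOf f := f.2

/-- The Tanner square complex `T_(i)` at level `i`. -/
def level : ℕ → TannerComplex
  | 0 => baseComplex
  | i + 1 => if Even i then replaceX m (level i) else replaceZ m (level i)

theorem level_succ_of_odd {i : ℕ} (hi : Odd i) : level m (i + 1) = replaceZ m (level m i) := by
  rw [level, if_neg (Nat.not_even_iff_odd.mpr hi)]

/-! ### Local complexes and the cochain map `F_{R_Z}` -/

/-- The local complex (the vertex of `T`) to which a check or qubit of `R_Z(T)` belongs. -/
def ownX (u : (replaceZ m T).X) : T.V := u.1.owner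
def ownQ (u : (replaceZ m T).Q) : T.V := u.1.owner
def ownZ (u : (replaceZ m T).Z) : T.V := u.1.owner

/-- The cochain spaces `C_v⁰`, `C_v¹`, `C_v²` of the local complex at `v`. -/
abbrev LC0 (v : T.V) : Type := {u : (replaceZ m T).X // ownX m T u = v} → F2
abbrev LC1 (v : T.V) : Type := {u : (replaceZ m T).Q // ownQ m T u = v} → F2
abbrev LC2 (v : T.V) : Type := {u : (replaceZ m T).Z // ownZ m T u = v} → F2

open Classical in
/-- The local coboundary maps `δ_v`. -/
def locδ0 (v : T.V) : LC0 m T v →ₗ[F2] LC1 m T v :=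
  ((replaceZ m T).mat0.submatrix Subtype.val Subtype.val).mulVecLin

open Classical in
def locδ1 (v : T.V) : LC1 m T v →ₗ[F2] LC2 m T v :=
  ((replaceZ m T).mat1.submatrix Subtype.val Subtype.val).mulVecLin

open Classical in
/-- The direct sum `δ_loc` of the local coboundary maps, as a map between the global spaces. -/
def δloc0 : (replaceZ m T).C0 →ₗ[F2] (replaceZ m T).C1 :=
  (Matrix.of fun q x =>
    if ownX m T x = ownQ m T q then (replaceZ m T).mat0 q x else 0).mulVecLin

open Classical in
def δloc1 : (replaceZ m T).C1 →ₗ[F2] (replaceZ m T).C2 :=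
  (Matrix.of fun z q =>
    if ownQ m T q = ownZ m T z then (replaceZ m T).mat1 z q else 0).mulVecLin

/-- The connecting maps `g = δ - δ_loc`. -/
def g0 : (replaceZ m T).C0 →ₗ[F2] (replaceZ m T).C1 := (replaceZ m T).δ0 - δloc0 m T
def g1 : (replaceZ m T).C1 →ₗ[F2] (replaceZ m T).C2 := (replaceZ m T).δ1 - δloc1 m T

/-- A choice, for every vertex `v` of `T`, of a homotopy `h` that contracts the local complex `C_v`
onto its cohomology, with the usual side conditions. For a retraction `p`, `ι` onto cohomology with
`p ι = 1`, `ι p = 1 + h δ + δ h`, `h ι = 0`, `p h = 0`, `h h = 0` the identities below hold;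
conversely they make `1 + h δ + δ h` the projection onto a space of representatives of the
cohomology. Such a choice exists for every finite cochain complex of vector spaces over a field. -/
structure LocalContraction where
  h1 : ∀ v : T.V, LC1 m T v →ₗ[F2] LC0 m T v
  h2 : ∀ v : T.V, LC2 m T v →ₗ[F2] LC1 m T v
  dhd0 : ∀ v, locδ0 m T v ∘ₗ h1 v ∘ₗ locδ0 m T v = locδ0 m T v
  dhd1 : ∀ v, locδ1 m T v ∘ₗ h2 v ∘ₗ locδ1 m T v = locδ1 m T v
  hdh1 : ∀ v, h1 v ∘ₗ locδ0 m T v ∘ₗ h1 v = h1 v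
  hdh2 : ∀ v, h2 v ∘ₗ locδ1 m T v ∘ₗ h2 v = h2 v
  hh : ∀ v, h1 v ∘ₗ h2 v = 0

open Classical in
/-- The representatives, in the bottom layer, of the generators of local cohomology: the point
over `x`, the point `q` of `Y_q`, the point `z` of `Y_z`. -/
def base0 : T.C0 →ₗ[F2] (replaceZ m T).C0 :=
  (Matrix.of fun (u : (replaceZ m T).X) x =>
    if u.1.1 = (PlanePoint.atX x, 0) then (1 : F2) else 0).mulVecLin

open Classical in
def base1 : T.C1 →ₗ[F2] (replaceZ m T).C1 :=
  (Matrix.of fun (u : (replaceZ m T).Q) q =>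
    if u.1.1 = (PlanePoint.atQ q, 0) then (1 : F2) else 0).mulVecLin

open Classical in
def base2 : T.C2 →ₗ[F2] (replaceZ m T).C2 :=
  (Matrix.of fun (u : (replaceZ m T).Z) z =>
    if u.1.1 = (PlanePoint.atZ z, 0) then (1 : F2) else 0).mulVecLin

namespace LocalContraction

variable {m T} (h : LocalContraction m T)

/-- The direct sums of the local homotopies. -/
def H1 : (replaceZ m T).C1 →ₗ[F2] (replaceZ m T).C0 :=
  LinearMap.pi fun u =>
    LinearMap.proj (⟨u, rfl⟩ : {u' : (replaceZ m T).X // ownX m T u' = ownX m T u}) ∘ₗ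
      h.h1 (ownX m T u) ∘ₗ LinearMap.funLeft F2 F2 Subtype.val

def H2 : (replaceZ m T).C2 →ₗ[F2] (replaceZ m T).C1 :=
  LinearMap.pi fun u =>
    LinearMap.proj (⟨u, rfl⟩ : {u' : (replaceZ m T).Q // ownQ m T u' = ownQ m T u}) ∘ₗ
      h.h2 (ownQ m T u) ∘ₗ LinearMap.funLeft F2 F2 Subtype.val

/-- The embedding `ι` of the generators of local cohomology by means of the representatives chosen by
`h`: a representative `c` of a class is replaced by `c + h δ_loc c + δ_loc h c`. -/
def ι0 : T.C0 →ₗ[F2] (replaceZ m T).C0 :=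
  (LinearMap.id + h.H1 ∘ₗ δloc0 m T) ∘ₗ base0 m T

def ι1 : T.C1 →ₗ[F2] (replaceZ m T).C1 :=
  (LinearMap.id + h.H2 ∘ₗ δloc1 m T + δloc0 m T ∘ₗ h.H1) ∘ₗ base1 m T

def ι2 : T.C2 →ₗ[F2] (replaceZ m T).C2 :=
  (LinearMap.id + δloc1 m T ∘ₗ h.H2) ∘ₗ base2 m T

/-- The cochain map `F_{R_Z} : C(T) → C(R_Z(T))` given by homological perturbation:
`F = (1 + h g + h g h g) ι`. In degree two `g = 0`. -/
def F_RZ0 : T.C0 →ₗ[F2] (replaceZ m T).C0 :=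
  (LinearMap.id + h.H1 ∘ₗ g0 m T + (h.H1 ∘ₗ g0 m T) ∘ₗ (h.H1 ∘ₗ g0 m T)) ∘ₗ h.ι0

def F_RZ1 : T.C1 →ₗ[F2] (replaceZ m T).C1 :=
  (LinearMap.id + h.H2 ∘ₗ g1 m T + (h.H2 ∘ₗ g1 m T) ∘ₗ (h.H2 ∘ₗ g1 m T)) ∘ₗ h.ι1

def F_RZ2 : T.C2 →ₗ[F2] (replaceZ m T).C2 := h.ι2

end LocalContraction

/-! ### Local computability -/

open Classical in
/-- The restriction of a 1-cochain to `Y_v`, extended by zero. -/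
def restr1 (v : T.V) (e : (replaceZ m T).C1) : (replaceZ m T).C1 :=
  fun u => if ownQ m T u = v then e u else 0

open Classical in
/-- The restriction of a 2-cochain to `Y_v`, extended by zero. -/
def restr2 (v : T.V) (σ : (replaceZ m T).C2) : (replaceZ m T).C2 :=
  fun u => if ownZ m T u = v then σ u else 0

open Classical in
/-- The part `ξ_v(k)` of `σ` in the local complexes at directed distance at most `k` to `v`. -/
def xi (k : ℕ∞) (v : T.V) (σ : (replaceZ m T).C2) : (replaceZ m T).C2 :=
  ∑ v' : T.V with T.dirDist v' v ≤ k, restr2 m T v' σ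

/-- Local computability of a coarse-graining map `σ ↦ (σ', f)`. -/
structure LocallyComputable (σ' : (replaceZ m T).B2 → T.B2)
    (f : (replaceZ m T).B2 → (replaceZ m T).C1) : Prop where
  /-- `f` is the sum of its local components, and the component at `v` is a function of `ξ_v(1)`. -/
  correction : ∃ φ : T.V → (replaceZ m T).C2 → (replaceZ m T).C1, ∀ σ : (replaceZ m T).B2,
    f σ = ∑ v : T.V, φ v (xi m T 1 v σ) ∧
    ∀ v : T.V, restr1 m T v (f σ) = φ v (xi m T 1 v σ)
  /-- The value of `σ'` at `z` is a function of `ξ_z(2)`. -/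
  syndrome : ∃ ψ : T.Z → (replaceZ m T).C2 → F2, ∀ (σ : (replaceZ m T).B2) (z : T.Z),
    (σ' σ : T.C2) z = ψ z (xi m T 2 (.inr (.inr z)) σ)

end Replacement

end CoarseGraining

end

noncomputable section

namespace CoarseGraining

open TannerComplex

/-! The map is `σ' = sumZ σ`, the sums of `σ` over the pieces `Y_z`, and `f = h σ`, the given local
homotopy applied to `σ`.

That `σ'` is again a syndrome follows from a chain-map identity (`HasProductLinks.sumZ_comp_δ1`):
summing over the pieces intertwines the two coboundaries. A qubit of `Y_z` meets exactly two
`Z`-checks, both in `Y_z`, and contributes `1 + 1 = 0`. A qubit of `Y_q` meets one `Z`-check in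
`Y_z` if `z` is joined to `q`, and none otherwise.

For the decomposition, each `Y_z` is connected through its qubits, so every `Z`-check of `Y_z` is
homologous to the copy of `z` at height 0. Hence `σ + base2 σ'` is a local coboundary
(`HasProductLinks.add_base2_sumZ_mem`). Since `δ_loc h` fixes local coboundaries, `σ = δ_loc h σ +
(1 + δ_loc h) base2 σ'`, and the last term is `F σ'`. Moreover `δ_loc h σ = δ¹ h σ`: the cochain `h
σ` is supported on qubits of the `Y_z`, whose `Z`-checks stay in the same piece.

The pieces are disjoint, which gives the weight bound, and both outputs at a piece depend on `σ` on
that piece only.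

The counts of neighbours need control of the gluing: an edge of the new complex may be seen in
several squares of `T`. The invariant `HasProductLinks` provides it. It holds for the base complex,
is self-dual, and passes from `T` to `replaceZ m T`, hence holds at every level. -/

variable {m : ℕ+} {T : TannerComplex}

/-! ### Coordinates in a single square -/

/-- Coordinates of a vertex of `U_Z`. -/
@[ext] structure Coord where
  a : ℕ
  b : ℕ
  c : ℕ

namespace Coord

/-- The coordinates after exchanging `a` and `b` if `s`. -/
def orient (s : Bool) (p : Coord) : Coord := if s then ⟨p.b, p.a, p.c⟩ else p

theorem orient_orient (s : Bool) (p : Coord) : (p.orient s).orient s = p := by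
  cases s <;> rfl

theorem parity_orient (s : Bool) (p : Coord) :
    (p.orient s).a % 2 + (p.orient s).b % 2 + (p.orient s).c % 2 =
      p.a % 2 + p.b % 2 + p.c % 2 := by
  cases s <;> simp only [Coord.orient, if_true, Bool.false_eq_true, if_false]
  omega

end Coord


/-- The coordinates are those of a vertex of `U_Z`. -/
def Coord.Valid (m : ℕ+) (p : Coord) : Prop :=
  p.a ≤ 2 * (m : ℕ) + 1 ∧ p.b ≤ 2 * (m : ℕ) + 1 ∧ p.c ≤ 2 ∧
    (p.c = 1 → p.a = 2 * (m : ℕ) ∨ p.b = 2 * (m : ℕ))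

/-- An edge of `U_Z`, directed so that an odd coordinate becomes even. -/
def Step (m : ℕ+) (p r : Coord) : Prop :=
  p.Valid m ∧ r.Valid m ∧
    (p.a % 2 = 1 ∧ (r.a = p.a + 1 ∨ r.a + 1 = p.a) ∧ r.b = p.b ∧ r.c = p.c ∨
     p.b % 2 = 1 ∧ (r.b = p.b + 1 ∨ r.b + 1 = p.b) ∧ r.a = p.a ∧ r.c = p.c ∨
     p.c % 2 = 1 ∧ (r.c = p.c + 1 ∨ r.c + 1 = p.c) ∧ r.a = p.a ∧ r.b = p.b)

/-- The vertex `v` has coordinates `p` in the square `f`, where `p.a` is measured towards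
`qOf f s`. -/
def At (f : T.F) (s : Bool) (p : Coord) (v : Vertex m T) : Prop :=
  v.1.1 = pt m T f (p.orient s).a (p.orient s).b ∧ (v.1.2 : ℕ) = p.c

theorem Coord.Valid.orient {p : Coord} (h : p.Valid m) (s : Bool) : (p.orient s).Valid m := by
  cases s
  · exact h
  · simp only [Coord.Valid, Coord.orient, if_true] at *
    omega

theorem Step.orient {p r : Coord} (h : Step m p r) (s : Bool) :
    Step m (p.orient s) (r.orient s) := by
  cases s
  · exact h
  · simp only [Step, Coord.Valid, Coord.orient, if_true] at *
    omega

theorem At.toFalse {f : T.F} {s : Bool} {p : Coord} {v : Vertex m T} (h : At f s p v) :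
    At f false (p.orient s) v :=
  ⟨h.1, h.2.trans (by cases s <;> rfl)⟩

theorem At.ofFalse {f : T.F} {p : Coord} {v : Vertex m T} (h : At f false p v) (s : Bool) :
    At f s (p.orient s) v :=
  ⟨by rw [Coord.orient_orient]; exact h.1, h.2.trans (by cases s <;> rfl)⟩

theorem At.odds {f : T.F} {s : Bool} {p : Coord} {v : Vertex m T} (h : At f s p v)
    (hp : p.Valid m) : v.odds = p.a % 2 + p.b % 2 + p.c % 2 := by
  have hp' := hp.orient s
  rw [Vertex.odds, h.1, h.2, odds_pt m T f _ _ hp'.1 hp'.2.1]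
  cases s <;> simp only [Coord.orient, if_true, Bool.false_eq_true, if_false]
  omega

theorem At.eq {f : T.F} {s : Bool} {p : Coord} {v w : Vertex m T} (h : At f s p v)
    (h' : At f s p w) : v = w :=
  Subtype.ext (Prod.ext (h.1.trans h'.1.symm) (Fin.ext (h.2.trans h'.2.symm)))

theorem exists_at (f : T.F) (s : Bool) {p : Coord} (hp : p.Valid m) :
    ∃ v : Vertex m T, At f s p v := by
  have hp' := hp.orient s
  refine ⟨⟨(pt m T f (p.orient s).a (p.orient s).b, ⟨p.c, by have := hp.2.2.1; omega⟩),
    fun h => ?_⟩, rfl, rfl⟩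
  have hc : (p.orient s).c = 1 := by
    rw [← Fin.val_inj] at h
    cases s <;> exact h
  rcases hp'.2.2.2 hc with h' | h' <;> simp only [h']
  · exact onStrip_pt_left m T f _
  · exact onStrip_pt_right m T f _

/-! ### Equality of grid points -/

section Points

variable (f : T.F)

theorem pt_eq_atZ {a b : ℕ} {z : T.Z}
    (h : pt m T f a b = .atZ z) : a = 0 ∧ b = 0 ∧ T.zOf f = z := by
  unfold pt at h
  simp only [Set.mem_Ioo] at h
  split_ifs at h
  simp_all

/-- The bounds matter: `pt` reads every larger value as `ℓ`, so coordinates are recovered only in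
range. -/
theorem pt_eq_atX {a b : ℕ} (ha : a ≤ 2 * m + 1) (hb : b ≤ 2 * m + 1) {x : T.X}
    (h : pt m T f a b = .atX x) : a = 2 * m + 1 ∧ b = 2 * m + 1 ∧ T.xOf f = x := by
  unfold pt at h
  simp only [Set.mem_Ioo] at h
  split_ifs at h
  simp_all
  omega

theorem pt_eq_inF {a b : ℕ} {f' : T.F} {a' b' : Set.Ioo 0 (2 * (m : ℕ) + 1)}
    (h : pt m T f a b = .inF f' a' b') : f = f' ∧ a = a' ∧ b = b' := by
  unfold pt at h
  simp only [Set.mem_Ioo] at h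
  split_ifs at h
  simp_all
  rcases h with ⟨-, rfl, rfl⟩
  simp

/-- The height 0 is a dummy that lets `orient` express on which of the two sides of the square the
point lies. -/
theorem pt_eq_atQ {a b : ℕ} (ha : a ≤ 2 * m + 1) (hb : b ≤ 2 * m + 1) {q : T.Q}
    (h : pt m T f a b = .atQ q) : ∃ s, T.qOf f s = q ∧
      (⟨a, b, 0⟩ : Coord) = (⟨2 * m + 1, 0, 0⟩ : Coord).orient s := by
  simp only [Bool.exists_bool, Coord.orient, Coord.mk.injEq, if_true, Bool.false_eq_true, if_false]
  unfold pt at h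
  simp only [Set.mem_Ioo] at h
  split_ifs at h <;> simp_all <;> omega

theorem pt_eq_onZQ {a b : ℕ} {z : T.Z} {q : T.Q}
    {hq : T.QZ q z} {k : Set.Ioo 0 (2 * (m : ℕ) + 1)}
    (h : pt m T f a b = .onZQ z q hq k) : T.zOf f = z ∧ ∃ s, T.qOf f s = q ∧
      (⟨a, b, 0⟩ : Coord) = (⟨k, 0, 0⟩ : Coord).orient s := by
  simp only [Bool.exists_bool, Coord.orient, Coord.mk.injEq, if_true, Bool.false_eq_true, if_false]
  unfold pt at h
  simp only [Set.mem_Ioo] at h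
  split_ifs at h <;> simp_all <;> obtain ⟨-, -, rfl⟩ := h <;> simp

theorem pt_eq_onQX {a b : ℕ} (ha : a ≤ 2 * m + 1) (hb : b ≤ 2 * m + 1) {x : T.X} {q : T.Q}
    {hq : T.XQ x q} {k : Set.Ioo 0 (2 * (m : ℕ) + 1)}
    (h : pt m T f a b = .onQX q x hq k) : T.xOf f = x ∧ ∃ s, T.qOf f s = q ∧
      (⟨a, b, 0⟩ : Coord) = (⟨2 * m + 1, k, 0⟩ : Coord).orient s := by
  simp only [Bool.exists_bool, Coord.orient, Coord.mk.injEq, if_true, Bool.false_eq_true, if_false]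
  unfold pt at h
  simp only [Set.mem_Ioo] at h
  split_ifs at h <;> simp_all <;> obtain ⟨-, -, rfl⟩ := h <;> simp <;> omega

end Points

/-! ### Passing from one square to another -/

/-- Gluing: a point of the edge `zq` depends on `z` and `q` only, so its coordinates carry over to
any other square with this edge. -/
theorem At.onZQ_congr {f f' : T.F} {s s' : Bool} {k c : ℕ} {v : Vertex m T}
    (h : At f s ⟨k, 0, c⟩ v) (hz : T.zOf f = T.zOf f') (hq : T.qOf f s = T.qOf f' s') :
    At f' s' ⟨k, 0, c⟩ v := by
  refine ⟨h.1.trans ?_, h.2⟩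
  cases s <;> cases s' <;> simp [Coord.orient, pt, hz, hq]

theorem At.onQ_congr {f f' : T.F} {s s' : Bool} {k c : ℕ} {v : Vertex m T}
    (hk : k = 2 * (m : ℕ) + 1)
    (h : At f s ⟨k, 0, c⟩ v) (hq : T.qOf f s = T.qOf f' s') :
    At f' s' ⟨k, 0, c⟩ v := by
  subst hk
  refine ⟨h.1.trans ?_, h.2⟩
  cases s <;> cases s' <;> simp [Coord.orient, pt, hq]

theorem At.onQX_congr {f f' : T.F} {s s' : Bool} {k j c : ℕ} {v : Vertex m T}
    (hk : k = 2 * (m : ℕ) + 1) (hj : 0 < j)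
    (h : At f s ⟨k, j, c⟩ v) (hx : T.xOf f = T.xOf f') (hq : T.qOf f s = T.qOf f' s') :
    At f' s' ⟨k, j, c⟩ v := by
  subst hk
  refine ⟨h.1.trans ?_, h.2⟩
  have := m.pos
  cases s <;> cases s' <;> simp [Coord.orient, pt, hx, hq, hj.ne']

/-- A qubit that has coordinates in two squares lies in the interior of a square, on a common edge
or at a common corner. -/
theorem At.compare {f₁ f₂ : T.F} {p₁ p₂ : Coord} {v : Vertex m T} (h₁ : At f₁ false p₁ v)
    (h₂ : At f₂ false p₂ v) (hp₁ : p₁.Valid m) (hp₂ : p₂.Valid m) (hv : v.odds = 1) :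
    (f₁ = f₂ ∧ p₁ = p₂ ∧ v.owner = .inr (.inr (T.zOf f₁)) ∧
      0 < p₁.a ∧ p₁.a ≤ 2 * m ∧ 0 < p₁.b ∧ p₁.b ≤ 2 * m) ∨
    ∃ t₁ t₂ k j c, T.qOf f₁ t₁ = T.qOf f₂ t₂ ∧ p₁ = Coord.orient t₁ ⟨k, j, c⟩ ∧
      p₂ = Coord.orient t₂ ⟨k, j, c⟩ ∧
      (T.zOf f₁ = T.zOf f₂ ∧ v.owner = .inr (.inr (T.zOf f₁)) ∧ 0 < k ∧ k ≤ 2 * m ∧ j = 0 ∨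
        v.owner = .inr (.inl (T.qOf f₁ t₁)) ∧ k = 2 * m + 1 ∧ j = 0 ∨
        T.xOf f₁ = T.xOf f₂ ∧ v.owner = .inr (.inl (T.qOf f₁ t₁)) ∧
          k = 2 * m + 1 ∧ 0 < j ∧ j ≤ 2 * m) := by
  have ho₁ := h₁.odds hp₁
  obtain ⟨e₁, c₁⟩ := h₁
  obtain ⟨e₂, c₂⟩ := h₂
  obtain ⟨a₁, b₁, d₁⟩ := p₁
  obtain ⟨a₂, b₂, d₂⟩ := p₂
  simp only [Coord.orient, Bool.false_eq_true, if_false] at e₁ e₂ c₁ c₂ ho₁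
  obtain rfl : d₁ = d₂ := c₁.symm.trans c₂
  simp only [Coord.Valid] at hp₁ hp₂
  -- Restores the common height in place of the dummy 0.
  have ext : ∀ {a b a' b' : ℕ} {t : Bool}, (⟨a, b, 0⟩ : Coord) = Coord.orient t ⟨a', b', 0⟩ →
      (⟨a, b, d₁⟩ : Coord) = Coord.orient t ⟨a', b', d₁⟩ := by
    intro a b a' b' t h
    cases t <;> simp_all [Coord.orient]
  rw [Vertex.owner]
  rcases hc : v.1.1 with z | ⟨z, q, hq, k⟩ | q | ⟨q, x, hq, k⟩ | x | ⟨f, a, b⟩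
  -- A qubit over the corner `z` would have height 1, which occurs on the strip only.
  · have := pt_eq_atZ f₁ (e₁.symm.trans hc)
    have := m.pos
    omega
  · obtain ⟨rfl, t₁, rfl, g₁⟩ := pt_eq_onZQ f₁ (e₁.symm.trans hc)
    obtain ⟨g, t₂, g', g₂⟩ := pt_eq_onZQ f₂ (e₂.symm.trans hc)
    have := k.2.1
    have := k.2.2
    exact .inr ⟨t₁, t₂, k, 0, d₁, g'.symm, ext g₁, ext g₂,
      .inl ⟨g.symm, rfl, by omega, by omega, rfl⟩⟩
  · obtain ⟨t₁, rfl, g₁⟩ := pt_eq_atQ f₁ hp₁.1 hp₁.2.1 (e₁.symm.trans hc)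
    obtain ⟨t₂, g', g₂⟩ := pt_eq_atQ f₂ hp₂.1 hp₂.2.1 (e₂.symm.trans hc)
    exact .inr ⟨t₁, t₂, _, 0, d₁, g'.symm, ext g₁, ext g₂, .inr (.inl ⟨rfl, rfl, rfl⟩)⟩
  · obtain ⟨rfl, t₁, rfl, g₁⟩ := pt_eq_onQX f₁ hp₁.1 hp₁.2.1 (e₁.symm.trans hc)
    obtain ⟨g, t₂, g', g₂⟩ := pt_eq_onQX f₂ hp₂.1 hp₂.2.1 (e₂.symm.trans hc)
    have := k.2.1
    have := k.2.2
    exact .inr ⟨t₁, t₂, _, k, d₁, g'.symm, ext g₁, ext g₂,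
      .inr (.inr ⟨g.symm, rfl, rfl, by omega, by omega⟩)⟩
  · have := pt_eq_atX f₁ hp₁.1 hp₁.2.1 (e₁.symm.trans hc)
    omega
  · obtain ⟨rfl, rfl, rfl⟩ := pt_eq_inF f₁ (e₁.symm.trans hc)
    obtain ⟨rfl, rfl, rfl⟩ := pt_eq_inF f₂ (e₂.symm.trans hc)
    have ha := a.2
    have hb := b.2
    rw [Set.mem_Ioo] at ha hb
    exact .inl ⟨rfl, rfl, rfl, by simp; omega, by simp; omega, by simp; omega, by simp; omega⟩

/-- Coordinates in a square with two different qubits are determined by the vertex. -/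
theorem At.coord_unique {f : T.F} (hf : T.qOf f false ≠ T.qOf f true) {p₁ p₂ : Coord}
    {v : Vertex m T} (h₁ : At f false p₁ v) (h₂ : At f false p₂ v) (hp₁ : p₁.Valid m)
    (hp₂ : p₂.Valid m) : p₁ = p₂ := by
  obtain ⟨e₁, c₁⟩ := h₁
  obtain ⟨e₂, c₂⟩ := h₂
  obtain ⟨a₁, b₁, d₁⟩ := p₁
  obtain ⟨a₂, b₂, d₂⟩ := p₂
  simp only [Coord.orient, Bool.false_eq_true, if_false] at e₁ e₂ c₁ c₂
  obtain rfl : d₁ = d₂ := c₁.symm.trans c₂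
  simp only [Coord.Valid] at hp₁ hp₂
  have ext : ∀ {a b a' b' a₂ b₂ : ℕ} {t s : Bool}, T.qOf f s = T.qOf f t →
      (⟨a, b, 0⟩ : Coord) = Coord.orient t ⟨a', b', 0⟩ →
      (⟨a₂, b₂, 0⟩ : Coord) = Coord.orient s ⟨a', b', 0⟩ →
      (⟨a, b, d₁⟩ : Coord) = ⟨a₂, b₂, d₁⟩ := by
    intro a b a' b' a₂ b₂ t s h
    cases t <;> cases s <;> simp_all [Coord.orient]
  rcases hc : v.1.1 with z | ⟨z, q, hq, k⟩ | q | ⟨q, x, hq, k⟩ | x | ⟨f', a, b⟩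
  · have := pt_eq_atZ f (e₁.symm.trans hc)
    have := pt_eq_atZ f (e₂.symm.trans hc)
    ext <;> simp only <;> omega
  · obtain ⟨-, t₁, rfl, g₁⟩ := pt_eq_onZQ f (e₁.symm.trans hc)
    obtain ⟨-, t₂, g', g₂⟩ := pt_eq_onZQ f (e₂.symm.trans hc)
    exact ext g' g₁ g₂
  · obtain ⟨t₁, rfl, g₁⟩ := pt_eq_atQ f hp₁.1 hp₁.2.1 (e₁.symm.trans hc)
    obtain ⟨t₂, g', g₂⟩ := pt_eq_atQ f hp₂.1 hp₂.2.1 (e₂.symm.trans hc)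
    exact ext g' g₁ g₂
  · obtain ⟨-, t₁, rfl, g₁⟩ := pt_eq_onQX f hp₁.1 hp₁.2.1 (e₁.symm.trans hc)
    obtain ⟨-, t₂, g', g₂⟩ := pt_eq_onQX f hp₂.1 hp₂.2.1 (e₂.symm.trans hc)
    exact ext g' g₁ g₂
  · have := pt_eq_atX f hp₁.1 hp₁.2.1 (e₁.symm.trans hc)
    have := pt_eq_atX f hp₂.1 hp₂.2.1 (e₂.symm.trans hc)
    ext <;> simp only <;> omega
  · obtain ⟨-, rfl, rfl⟩ := pt_eq_inF f (e₁.symm.trans hc)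
    obtain ⟨-, rfl, rfl⟩ := pt_eq_inF f (e₂.symm.trans hc)
    rfl

/-! ### Corners of the unit squares -/

namespace UnitSquare

/-- The coordinates of the `X`-corner. -/
def xCoord : UnitSquare m → Coord
  | .layer t i j => ⟨od i, od j, (outer t : ℕ)⟩
  | .strip false j _ => ⟨2 * m, od j, 1⟩
  | .strip true j _ => ⟨od j, 2 * m, 1⟩

/-- The coordinates of the `Z`-corner. -/
def zCoord : UnitSquare m → Coord
  | .layer t i j => ⟨ev i, ev j, (outer t : ℕ)⟩
  | .strip false j t => ⟨2 * m, ev j, (outer t : ℕ)⟩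
  | .strip true j t => ⟨ev j, 2 * m, (outer t : ℕ)⟩

/-- The coordinates of the qubit corners. -/
def qCoord : UnitSquare m → Bool → Coord
  | .layer t i j, false => ⟨od i, ev j, (outer t : ℕ)⟩
  | .layer t i j, true => ⟨ev i, od j, (outer t : ℕ)⟩
  | .strip false j t, false => ⟨2 * m, od j, (outer t : ℕ)⟩
  | .strip true j t, false => ⟨od j, 2 * m, (outer t : ℕ)⟩
  | .strip false j _, true => ⟨2 * m, ev j, 1⟩
  | .strip true j _, true => ⟨ev j, 2 * m, 1⟩

theorem at_xCorner (f : T.F) (U : UnitSquare m) : At f false U.xCoord (xCorner f U).1 := by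
  rcases U with ⟨t, i, j⟩ | ⟨_ | _, j, t⟩ <;> exact ⟨rfl, rfl⟩

theorem at_zCorner (f : T.F) (U : UnitSquare m) : At f false U.zCoord (zCorner f U).1 := by
  rcases U with ⟨t, i, j⟩ | ⟨_ | _, j, t⟩ <;> exact ⟨rfl, rfl⟩

theorem at_qCorner (f : T.F) (U : UnitSquare m) (s : Bool) :
    At f false (U.qCoord s) (qCorner f U s).1 := by
  rcases U with ⟨t, i, j⟩ | ⟨_ | _, j, t⟩ <;> cases s <;> exact ⟨rfl, rfl⟩

theorem step_xq (U : UnitSquare m) (s : Bool) : Step m U.xCoord (U.qCoord s) := by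
  have := m.pos
  rcases U with ⟨_ | _, i, j⟩ | ⟨_ | _, j, _ | _⟩ <;> cases s <;>
    simp [Step, Coord.Valid, xCoord, qCoord, ev, od, outer] <;> omega

theorem step_qz (U : UnitSquare m) (s : Bool) : Step m (U.qCoord s) U.zCoord := by
  have := m.pos
  rcases U with ⟨_ | _, i, j⟩ | ⟨_ | _, j, _ | _⟩ <;> cases s <;>
    simp [Step, Coord.Valid, zCoord, qCoord, ev, od, outer] <;> omega

/-- The `X`- and `Z`-corner are opposite, so they determine the unit square; the qubit then selects
one of the two remaining corners. -/
theorem coord_injective {U U' : UnitSquare m} {s s' : Bool} (hx : U.xCoord = U'.xCoord)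
    (hq : U.qCoord s = U'.qCoord s') (hz : U.zCoord = U'.zCoord) : U = U' ∧ s = s' := by
  rcases U with ⟨t, i, j⟩ | ⟨_ | _, j, t⟩ <;> rcases U' with ⟨t', i', j'⟩ | ⟨_ | _, j', t'⟩ <;>
    cases s <;> cases s' <;> cases t <;> cases t' <;>
    simp [xCoord, qCoord, zCoord, ev, od, outer, Fin.ext_iff] at hx hq hz ⊢ <;> omega

/-- The unit interval with ends `x` and `y` starts at `min x y`. -/
theorem exists_od_ev {x y : ℕ} (h1 : x % 2 = 1) (h2 : x ≤ 2 * (m : ℕ) + 1)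
    (h3 : y = x + 1 ∨ y + 1 = x) (h4 : y ≤ 2 * (m : ℕ) + 1) :
    ∃ i : Fin (2 * (m : ℕ) + 1), od i = x ∧ ev i = y := by
  refine ⟨⟨min x y, by omega⟩, ?_, ?_⟩ <;> simp only [od, ev] <;> omega

theorem exists_outer {y : ℕ} (h : y = 0 ∨ y = 2) : ∃ t : Bool, ((outer t : Fin 3) : ℕ) = y := by
  rcases h with rfl | rfl
  exacts [⟨false, rfl⟩, ⟨true, rfl⟩]

/-- The two steps make two different odd coordinates even, so they run around half of a unit square.
Which coordinates these are, and in which order, fixes the kind of square and the qubit corner. -/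
theorem exists_coord {p r u : Coord} (hpr : Step m p r) (hru : Step m r u)
    (hp : p.a % 2 + p.b % 2 + p.c % 2 = 2) :
    ∃ (U : UnitSquare m) (s : Bool), U.xCoord = p ∧ U.qCoord s = r ∧ U.zCoord = u := by
  obtain ⟨a, b, c⟩ := p
  obtain ⟨a', b', c'⟩ := r
  obtain ⟨a'', b'', c''⟩ := u
  obtain ⟨v₁, v₂, h⟩ := hpr
  obtain ⟨-, v₃, h'⟩ := hru
  dsimp only [Coord.Valid] at *
  obtain ⟨h₁, h₂, rfl, rfl⟩ | ⟨h₁, h₂, rfl, rfl⟩ | ⟨h₁, h₂, rfl, rfl⟩ := h <;>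
    obtain ⟨h₃, h₄, rfl, rfl⟩ | ⟨h₃, h₄, rfl, rfl⟩ | ⟨h₃, h₄, rfl, rfl⟩ := h'
  · omega
  · obtain ⟨t, ht⟩ := exists_outer (y := c'') (by omega)
    obtain ⟨i, hi, hi'⟩ := exists_od_ev (m := m) h₁ (by omega) h₂ (by omega)
    obtain ⟨j, hj, hj'⟩ := exists_od_ev (m := m) h₃ (by omega) h₄ (by omega)
    exact ⟨.layer t i j, true, by simp [xCoord, hi, hj, ht], by simp [qCoord, hi', hj, ht],
      by simp [zCoord, hi', hj', ht]⟩
  · obtain ⟨t, ht⟩ := exists_outer (y := c'') (by omega)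
    obtain ⟨i, hi, hi'⟩ := exists_od_ev (m := m) h₁ (by omega) h₂ (by omega)
    exact ⟨.strip true i t, true, by simp [xCoord, hi]; omega, by simp [qCoord, hi']; omega,
      by simp [zCoord, hi', ht]; omega⟩
  · obtain ⟨t, ht⟩ := exists_outer (y := c'') (by omega)
    obtain ⟨i, hi, hi'⟩ := exists_od_ev (m := m) h₃ (by omega) h₄ (by omega)
    obtain ⟨j, hj, hj'⟩ := exists_od_ev (m := m) h₁ (by omega) h₂ (by omega)
    exact ⟨.layer t i j, false, by simp [xCoord, hi, hj, ht], by simp [qCoord, hi, hj', ht],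
      by simp [zCoord, hi', hj', ht]⟩
  · omega
  · obtain ⟨t, ht⟩ := exists_outer (y := c'') (by omega)
    obtain ⟨i, hi, hi'⟩ := exists_od_ev (m := m) h₁ (by omega) h₂ (by omega)
    exact ⟨.strip false i t, true, by simp [xCoord, hi]; omega, by simp [qCoord, hi']; omega,
      by simp [zCoord, hi', ht]; omega⟩
  · obtain ⟨t, ht⟩ := exists_outer (y := c'') (by omega)
    obtain ⟨i, hi, hi'⟩ := exists_od_ev (m := m) h₃ (by omega) h₄ (by omega)
    exact ⟨.strip true i t, false, by simp [xCoord, hi]; omega, by simp [qCoord, hi, ht]; omega,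
      by simp [zCoord, hi', ht]; omega⟩
  · obtain ⟨t, ht⟩ := exists_outer (y := c'') (by omega)
    obtain ⟨i, hi, hi'⟩ := exists_od_ev (m := m) h₃ (by omega) h₄ (by omega)
    exact ⟨.strip false i t, false, by simp [xCoord, hi]; omega, by simp [qCoord, hi, ht]; omega,
      by simp [zCoord, hi', ht]; omega⟩
  · omega

end UnitSquare

/-! ### Links of qubits -/

/-- Every check lies on a square, and the squares at a qubit correspond to the pairs of an `X`-check
and a `Z`-check joined to it. -/
structure HasProductLinks (T : TannerComplex) : Prop where
  exists_x : ∀ x : T.X, ∃ f, T.xOf f = x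
  exists_z : ∀ z : T.Z, ∃ f, T.zOf f = z
  exists_square : ∀ x q z, T.XQ x q → T.QZ q z →
    ∃ f s, T.xOf f = x ∧ T.qOf f s = q ∧ T.zOf f = z
  square_unique : ∀ f f' s s', T.xOf f = T.xOf f' → T.qOf f s = T.qOf f' s' →
    T.zOf f = T.zOf f' → f = f' ∧ s = s'

theorem HasProductLinks.dual (hT : HasProductLinks T) : HasProductLinks T.dual where
  exists_x := hT.exists_z
  exists_z := hT.exists_x
  exists_square x q z := by
    rintro ⟨f, s, hx, hq⟩ ⟨f', s', hq', hz⟩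
    obtain ⟨f, s, h₁, h₂, h₃⟩ := hT.exists_square z q x ⟨f', s', hz, hq'⟩ ⟨f, s, hq, hx⟩
    exact ⟨f, s, h₃, h₂, h₁⟩
  square_unique f f' s s' hx hq hz := hT.square_unique f f' s s' hz hq hx

theorem HasProductLinks.q_ne (hT : HasProductLinks T) (f : T.F) :
    T.qOf f false ≠ T.qOf f true := fun h =>
  Bool.false_ne_true (hT.square_unique f f false true rfl h rfl).2

theorem hasProductLinks_baseComplex : HasProductLinks baseComplex where
  exists_x x := ⟨(x, x), rfl⟩
  exists_z z := ⟨(z, z), rfl⟩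
  exists_square := by
    rintro x q z ⟨⟨a, b⟩, s, rfl, rfl⟩ ⟨⟨c, d⟩, s', h, rfl⟩
    -- At the central qubit every pair of checks spans a square; every other qubit lies on one
    -- square only.
    refine ⟨(a, d), s, rfl, ?_, rfl⟩
    cases s <;> cases s' <;> simp_all [baseComplex]
  square_unique := by
    rintro ⟨a, b⟩ ⟨c, d⟩ s s' h₁ h₂ h₃
    cases s <;> cases s' <;> simp_all [baseComplex]

theorem TannerComplex.XQ.exists_step {x : (replaceZ m T).X} {q : (replaceZ m T).Q}
    (h : (replaceZ m T).XQ x q) :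
    ∃ f p r, At f false p x.1 ∧ At f false r q.1 ∧ Step m p r := by
  obtain ⟨⟨f, U⟩, s, rfl, rfl⟩ := h
  exact ⟨f, U.xCoord, U.qCoord s, U.at_xCorner f, U.at_qCorner f s, U.step_xq s⟩

theorem TannerComplex.QZ.exists_step {q : (replaceZ m T).Q} {z : (replaceZ m T).Z}
    (h : (replaceZ m T).QZ q z) :
    ∃ f r u, At f false r q.1 ∧ At f false u z.1 ∧ Step m r u := by
  obtain ⟨⟨f, U⟩, s, rfl, rfl⟩ := h
  exact ⟨f, U.qCoord s, U.zCoord, U.at_qCorner f s, U.at_zCorner f, U.step_qz s⟩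

/-- Reduces incidence in the new complex to coordinates: it suffices to see all three vertices in
one square of `T`. -/
theorem At.exists_square {f : T.F} {p r u : Coord} {x : (replaceZ m T).X} {q : (replaceZ m T).Q}
    {z : (replaceZ m T).Z} (hx : At f false p x.1) (hq : At f false r q.1)
    (hz : At f false u z.1) (hpr : Step m p r) (hru : Step m r u) :
    ∃ F s, (replaceZ m T).xOf F = x ∧ (replaceZ m T).qOf F s = q ∧ (replaceZ m T).zOf F = z := by
  obtain ⟨U, s, rfl, rfl, rfl⟩ := UnitSquare.exists_coord hpr hru
    ((hx.odds hpr.1).symm.trans x.2)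
  exact ⟨(f, U), s, Subtype.ext ((U.at_xCorner f).eq hx), Subtype.ext ((U.at_qCorner f s).eq hq),
    Subtype.ext ((U.at_zCorner f).eq hz)⟩

/-! ### Steps near the edges and corners of a square -/

theorem At.owner_z {f : T.F} {s : Bool} {p : Coord} {v : Vertex m T} (h : At f s p v)
    (ha : p.a ≤ 2 * m) (hb : p.b ≤ 2 * m) : v.owner = .inr (.inr (T.zOf f)) := by
  have key : ∀ {a b : ℕ}, a ≤ 2 * m → b ≤ 2 * m →
      (pt m T f a b).owner = .inr (.inr (T.zOf f)) := by
    intro a b ha hb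
    unfold pt
    simp only [Set.mem_Ioo]
    split_ifs <;> first | rfl | omega
  rw [Vertex.owner, h.1]
  cases s
  · exact key ha hb
  · exact key hb ha

theorem At.xOf_eq {f f' : T.F} {s s' : Bool} {k j c c' : ℕ} {v : Vertex m T}
    (h : At f s ⟨k, j, c⟩ v) (h' : At f' s' ⟨k, j, c'⟩ v)
    (hk : k = 2 * (m : ℕ) + 1) (h0 : 0 < j) (hj : j ≤ 2 * m) : T.xOf f = T.xOf f' := by
  subst hk
  have e := h.1.symm.trans h'.1
  have : j < 2 * m + 1 := by omega
  cases s <;> cases s' <;> simp [Coord.orient, pt, h0, this] at e <;> exact e.2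

theorem At.face_eq {f f' : T.F} {p p' : Coord} {v : Vertex m T} (h : At f false p v)
    (h' : At f' false p' v) (ha : 0 < p.a) (ha' : p.a ≤ 2 * m) (hb : 0 < p.b)
    (hb' : p.b ≤ 2 * m) : f = f' := by
  have e := h'.1.symm.trans h.1
  have hA : p.a < 2 * m + 1 := by omega
  have hB : p.b < 2 * m + 1 := by omega
  rw [show pt m T f (p.orient false).a (p.orient false).b = .inF f ⟨p.a, ha, hA⟩ ⟨p.b, hb, hB⟩ by
    simp [Coord.orient, pt, ha, hb, hA, hB]] at e
  exact (pt_eq_inF f' e).1.symm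

/-- A step changes an odd coordinate only, and `b = 0` is even. -/
theorem Step.of_onZQ {k c : ℕ} {u : Coord} (h : Step m ⟨k, 0, c⟩ u) : u.b = 0 := by
  simp only [Step, Coord.Valid] at h
  omega

/-- A step never ends at an odd value of the coordinate it changes, so `a = ℓ` was already there
before it. -/
theorem Step.of_onQX {k j c : ℕ} {p : Coord} (h : Step m p ⟨k, j, c⟩) (hk : k = 2 * (m : ℕ) + 1)
    (h0 : p.a % 2 + p.b % 2 + p.c % 2 = 2) : p.a = 2 * m + 1 ∧ 0 < p.b := by
  have hm := m.pos
  simp only [Step, Coord.Valid] at h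
  omega

theorem Step.onQ_eq {k c : ℕ} {p u : Coord} (h : Step m p ⟨k, 0, c⟩) (h' : Step m ⟨k, 0, c⟩ u)
    (hk : k = 2 * (m : ℕ) + 1) : p = ⟨k, 1, c⟩ ∧ u = ⟨2 * m, 0, c⟩ := by
  have hm := m.pos
  simp only [Step, Coord.Valid] at h h'
  refine ⟨?_, ?_⟩ <;> ext <;> simp only <;> omega

theorem Coord.Valid.exists_step_from {p : Coord} (hp : p.Valid m)
    (h : 0 < p.a % 2 + p.b % 2 + p.c % 2) : ∃ r, Step m p r := by
  obtain ⟨a, b, c⟩ := p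
  obtain ⟨h₁, h₂, h₃, h₄⟩ := hp
  dsimp only at *
  have hm := m.pos
  by_cases hc : c = 1
  · exact ⟨⟨a, b, 0⟩, ⟨h₁, h₂, h₃, h₄⟩, ⟨h₁, h₂, by simp, by simp⟩,
      .inr (.inr ⟨by simp [hc], .inr hc.symm, rfl, rfl⟩)⟩
  by_cases ha : a % 2 = 1
  · exact ⟨⟨a - 1, b, c⟩, ⟨h₁, h₂, h₃, h₄⟩, ⟨by dsimp only; omega, h₂, h₃, fun h => absurd h hc⟩,
      .inl ⟨ha, .inr (by dsimp only; omega), rfl, rfl⟩⟩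
  · exact ⟨⟨a, b - 1, c⟩, ⟨h₁, h₂, h₃, h₄⟩, ⟨h₁, by dsimp only; omega, h₃, fun h => absurd h hc⟩,
      .inr (.inl ⟨by dsimp only; omega, .inr (by dsimp only; omega), rfl, rfl⟩)⟩

theorem Coord.Valid.exists_step_to {r : Coord} (hr : r.Valid m)
    (h : r.a % 2 + r.b % 2 + r.c % 2 ≤ 1) : ∃ p, Step m p r := by
  obtain ⟨a, b, c⟩ := r
  obtain ⟨h₁, h₂, h₃, h₄⟩ := hr
  dsimp only at *
  have hm := m.pos
  -- At height 1 the coordinate `a` may vary over the line `b = ℓ - 1` only.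
  by_cases ha : a % 2 = 0 ∧ (c = 1 → b = 2 * m)
  · exact ⟨⟨a + 1, b, c⟩, ⟨by dsimp only; omega, h₂, h₃, fun h => .inr (ha.2 h)⟩,
      ⟨h₁, h₂, h₃, h₄⟩, .inl ⟨by dsimp only; omega, .inr rfl, rfl, rfl⟩⟩
  · exact ⟨⟨a, b + 1, c⟩, ⟨h₁, by dsimp only; omega, h₃, fun h => .inl (by dsimp only at *; omega)⟩,
      ⟨h₁, h₂, h₃, h₄⟩, .inr (.inl ⟨by dsimp only; omega, .inr rfl, rfl, rfl⟩)⟩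

theorem Step.parity {p r : Coord} (h : Step m p r) :
    p.a % 2 + p.b % 2 + p.c % 2 = r.a % 2 + r.b % 2 + r.c % 2 + 1 := by
  simp only [Step, Coord.Valid] at h
  omega

/-! ### Product links pass to the replacement -/

/-- Every vertex that is not over a qubit of `T` has coordinates in some square. -/
theorem HasProductLinks.exists_coord (hT : HasProductLinks T) (v : Vertex m T)
    (hne : ∀ q, v.1.1 ≠ .atQ q) :
    ∃ f s p, Coord.Valid m p ∧ At f s p v := by
  obtain ⟨⟨P, c⟩, hv⟩ := v
  have hm := m.pos
  have hv' : (c : ℕ) = 1 → P.OnStrip := fun h => hv (Fin.ext h)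
  have hc : (c : ℕ) ≤ 2 := by omega
  rcases P with z | ⟨z, q, ⟨f, s, rfl, rfl⟩, k⟩ | q | ⟨q, x, ⟨f, s, rfl, rfl⟩, k⟩ | x | ⟨f, a, b⟩
  · obtain ⟨f, rfl⟩ := hT.exists_z z
    simp only [PlanePoint.OnStrip, imp_false] at hv'
    exact ⟨f, false, ⟨0, 0, c⟩, by simp only [Coord.Valid]; omega, by simp [Coord.orient, pt], rfl⟩
  · obtain ⟨k, h0, hk⟩ := k
    simp only [PlanePoint.OnStrip] at hv'
    refine ⟨f, s, ⟨k, 0, c⟩, by simp only [Coord.Valid]; omega, ?_, rfl⟩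
    cases s <;> simp [Coord.orient, pt, h0, hk]
  · exact absurd rfl (hne q)
  · obtain ⟨k, h0, hk⟩ := k
    simp only [PlanePoint.OnStrip] at hv'
    refine ⟨f, s, ⟨2 * m + 1, k, c⟩, by simp only [Coord.Valid]; omega, ?_, rfl⟩
    cases s <;> simp [Coord.orient, pt, h0, hk]
  · obtain ⟨f, rfl⟩ := hT.exists_x x
    simp only [PlanePoint.OnStrip, imp_false] at hv'
    exact ⟨f, false, ⟨2 * m + 1, 2 * m + 1, c⟩, by simp only [Coord.Valid]; omega,
      by simp [Coord.orient, pt], rfl⟩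
  · obtain ⟨a, ha, ha'⟩ := a
    obtain ⟨b, hb, hb'⟩ := b
    simp only [PlanePoint.OnStrip] at hv'
    exact ⟨f, false, ⟨a, b, c⟩, by simp only [Coord.Valid]; omega,
      by simp [Coord.orient, pt, ha, ha', hb, hb'], rfl⟩

/-- The two edges may be seen in different squares `f₁`, `f₂` of `T`; they have to be moved into
one. If the qubit is interior, the squares agree. On an edge `zq` the `Z`-check lies on that edge
too and moves to `f₁`; on an edge `qx` the `X`-check moves to `f₂`. -/
theorem HasProductLinks.replaceZ_exists_square (hT : HasProductLinks T) (x : (replaceZ m T).X)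
    (q : (replaceZ m T).Q) (z : (replaceZ m T).Z) (hxq : (replaceZ m T).XQ x q)
    (hqz : (replaceZ m T).QZ q z) : ∃ F s, (replaceZ m T).xOf F = x ∧
      (replaceZ m T).qOf F s = q ∧ (replaceZ m T).zOf F = z := by
  obtain ⟨f₁, p₁, r₁, hp₁, hr₁, h₁⟩ := XQ.exists_step hxq
  obtain ⟨f₂, r₂, u₂, hr₂, hu₂, h₂⟩ := QZ.exists_step hqz
  have hpar := (hp₁.odds h₁.1).symm.trans x.2
  have hm := m.pos
  obtain ⟨rfl, rfl, -⟩ | ⟨t₁, t₂, k, j, c, hq, rfl, rfl, hc⟩ :=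
    hr₁.compare hr₂ h₁.2.1 h₂.1 q.2
  · exact hp₁.exists_square hr₁ hu₂ h₁ h₂
  have g₁ := h₁.orient t₁
  have g₂ := h₂.orient t₂
  have hr := hr₁.ofFalse t₁
  have hp := hp₁.ofFalse t₁
  have hu := hu₂.ofFalse t₂
  rw [Coord.orient_orient] at g₁ g₂ hr
  rcases hc with ⟨hz, -, hk, hk', rfl⟩ | ⟨-, hk, rfl⟩ | ⟨hx, -, hk, hj, hj'⟩
  · have hb := g₂.of_onZQ
    generalize u₂.orient t₂ = u at *
    obtain ⟨a, b, d⟩ := u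
    obtain rfl : b = 0 := hb
    exact hp₁.exists_square hr₁ ((hu.onZQ_congr hz.symm hq.symm).toFalse) h₁
      (g₂.orient t₁)
  · obtain ⟨e₁, e₂⟩ := g₁.onQ_eq g₂ hk
    rw [e₁] at g₁ hp
    rw [e₂] at g₂ hu
    -- At the corner `q` itself neither square need contain both edges; the link of `q` in `T`
    -- supplies a third square that does.
    obtain ⟨f, t, hx', hq', hz'⟩ := hT.exists_square _ _ _ (T.xq_self f₁ t₁)
      (hq ▸ T.qz_self f₂ t₂)
    exact ((hp.onQX_congr hk one_pos hx'.symm hq'.symm).toFalse).exists_square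
      ((hr.onQ_congr hk hq'.symm).toFalse)
      ((hu.onZQ_congr hz'.symm (hq.symm.trans hq'.symm)).toFalse)
      (g₁.orient t) (g₂.orient t)
  · obtain ⟨ha, hb⟩ := g₁.of_onQX hk ((Coord.parity_orient t₁ p₁).trans hpar)
    generalize p₁.orient t₁ = p at *
    obtain ⟨a, b, d⟩ := p
    exact ((hp.onQX_congr ha hb hx hq).toFalse).exists_square hr₂ hu₂ (g₁.orient t₂) h₂

/-- Only the square of `T` has to be recovered, since coordinates inside it are unique. If the qubit
is over an edge `zq` or `qx`, the `X`- or the `Z`-corner, respectively, is interior and names the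
square. At the corner `q` the two checks lie on edges `qx` and `zq`, and uniqueness in `T` applies.
-/
theorem HasProductLinks.replaceZ_square_unique (hT : HasProductLinks T) (F F' : (replaceZ m T).F)
    (s s' : Bool) (hx : (replaceZ m T).xOf F = (replaceZ m T).xOf F')
    (hq : (replaceZ m T).qOf F s = (replaceZ m T).qOf F' s')
    (hz : (replaceZ m T).zOf F = (replaceZ m T).zOf F') : F = F' ∧ s = s' := by
  obtain ⟨f, U⟩ := F
  obtain ⟨f', U'⟩ := F'
  have hm := m.pos
  have x₁ := U.at_xCorner f
  have x₂ := U'.at_xCorner f'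
  have q₁ := U.at_qCorner f s
  have q₂ := U'.at_qCorner f' s'
  have z₁ := U.at_zCorner f
  have z₂ := U'.at_zCorner f'
  change xCorner f U = xCorner f' U' at hx
  change qCorner f U s = qCorner f' U' s' at hq
  change zCorner f U = zCorner f' U' at hz
  rw [← hx] at x₂
  rw [← hq] at q₂
  rw [← hz] at z₂
  have hf : f = f' := by
    have h₁ := U.step_xq s
    have h₂ := U.step_qz s
    have hpar := (x₁.odds h₁.1).symm.trans (xCorner f U).2
    obtain ⟨rfl, -⟩ | ⟨t₁, t₂, k, j, c, hq, hr₁, hr₂, hc⟩ :=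
      q₁.compare q₂ (U.step_xq s).2.1 (U'.step_xq s').2.1 (qCorner f U s).2
    · rfl
    rw [hr₁] at h₁ h₂
    rcases hc with ⟨-, -, hk, hk', rfl⟩ | ⟨-, hk, rfl⟩ | ⟨-, -, hk, hj, hj'⟩
    · have : 0 < U.xCoord.a ∧ U.xCoord.a ≤ 2 * m ∧ 0 < U.xCoord.b ∧ U.xCoord.b ≤ 2 * m := by
        cases t₁ <;> simp only [Step, Coord.Valid, Coord.orient, if_true, Bool.false_eq_true,
          if_false] at h₁ hpar <;> omega
      exact x₁.face_eq x₂ this.1 this.2.1 this.2.2.1 this.2.2.2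
    · have g₁ := h₁.orient t₁
      have g₂ := h₂.orient t₁
      rw [Coord.orient_orient] at g₁ g₂
      obtain ⟨e₁, e₂⟩ := g₁.onQ_eq g₂ hk
      have k₁ := (U'.step_xq s').orient t₂
      have k₂ := (U'.step_qz s').orient t₂
      rw [hr₂, Coord.orient_orient] at k₁ k₂
      obtain ⟨i₁, i₂⟩ := k₁.onQ_eq k₂ hk
      have X₁ := x₁.ofFalse t₁
      have X₂ := x₂.ofFalse t₂
      have Z₁ := z₁.ofFalse t₁
      have Z₂ := z₂.ofFalse t₂
      rw [e₁] at X₁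
      rw [i₁] at X₂
      rw [e₂] at Z₁
      rw [i₂] at Z₂
      have hz := (Z₁.owner_z le_rfl (Nat.zero_le _)).symm.trans
        (Z₂.owner_z le_rfl (Nat.zero_le _))
      exact (hT.square_unique f f' t₁ t₂ (X₁.xOf_eq X₂ hk one_pos (by omega)) hq
        (Sum.inr_injective (Sum.inr_injective hz))).1
    · have : 0 < U.zCoord.a ∧ U.zCoord.a ≤ 2 * m ∧ 0 < U.zCoord.b ∧ U.zCoord.b ≤ 2 * m := by
        cases t₁ <;> simp only [Step, Coord.Valid, Coord.orient, if_true, Bool.false_eq_true,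
          if_false] at h₁ h₂ hpar <;> omega
      exact z₁.face_eq z₂ this.1 this.2.1 this.2.2.1 this.2.2.2
  subst hf
  have hne := hT.q_ne f
  obtain ⟨rfl, rfl⟩ := UnitSquare.coord_injective
    (At.coord_unique hne x₁ x₂ (U.step_xq s).1 (U'.step_xq s').1)
    (At.coord_unique hne q₁ q₂ (U.step_xq s).2.1 (U'.step_xq s').2.1)
    (At.coord_unique hne z₁ z₂ (U.step_qz s).2.1 (U'.step_qz s').2.1)
  exact ⟨rfl, rfl⟩

theorem hasProductLinks_replaceZ (hT : HasProductLinks T) : HasProductLinks (replaceZ m T) where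
  exists_x x := by
    -- An `X`-check over a qubit of `T` would have height 1, off the strip.
    obtain ⟨f, s, p', hp', hx'⟩ := hT.exists_coord x.1 fun q hq => by
      have h := x.2
      have h' := x.1.2
      rw [Vertex.odds, hq, PlanePoint.odds] at h
      rw [hq, ← Fin.val_inj] at h'
      exact h' (show (x.1.1.2 : ℕ) = 1 by omega)
    have hp := hp'.orient s
    have hx := hx'.toFalse
    generalize p'.orient s = p at *
    have hpar := (hx.odds hp).symm.trans x.2
    obtain ⟨r, hr⟩ := hp.exists_step_from (by omega)
    have := hr.parity
    obtain ⟨u, hu⟩ := hr.2.1.exists_step_from (by omega)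
    have := hu.parity
    obtain ⟨q, hq⟩ := exists_at f false hr.2.1
    obtain ⟨z, hz⟩ := exists_at f false hu.2.1
    obtain ⟨F, -, hF, -⟩ := At.exists_square (x := x) (q := ⟨q, (hq.odds hr.2.1).trans (by omega)⟩)
      (z := ⟨z, (hz.odds hu.2.1).trans (by omega)⟩) hx hq hz hr hu
    exact ⟨F, hF⟩
  exists_z z := by
    obtain ⟨f, s, p', hp', hz'⟩ := hT.exists_coord z.1 fun q hq => by
      have := z.2
      rw [Vertex.odds, hq, PlanePoint.odds] at this
      omega
    have hu := hp'.orient s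
    have hz := hz'.toFalse
    generalize p'.orient s = u at *
    have hpar := (hz.odds hu).symm.trans z.2
    obtain ⟨r, hr⟩ := hu.exists_step_to (by omega)
    have := hr.parity
    obtain ⟨p, hp⟩ := hr.1.exists_step_to (by omega)
    have := hp.parity
    obtain ⟨q, hq⟩ := exists_at f false hr.1
    obtain ⟨x, hx⟩ := exists_at f false hp.1
    obtain ⟨F, -, -, -, hF⟩ := At.exists_square (z := z) (q := ⟨q, (hq.odds hr.1).trans (by omega)⟩)
      (x := ⟨x, (hx.odds hp.1).trans (by omega)⟩) hx hq hz hp hr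
    exact ⟨F, hF⟩
  exists_square := hT.replaceZ_exists_square
  square_unique := hT.replaceZ_square_unique

/-- The property is self-dual, and `R_X` is `R_Z` conjugated by `dual`. -/
theorem hasProductLinks_level (i : ℕ) : HasProductLinks (level m i) := by
  induction i with
  | zero => exact hasProductLinks_baseComplex
  | succ i ih =>
    rw [level]
    split_ifs
    · exact (hasProductLinks_replaceZ ih.dual).dual
    · exact hasProductLinks_replaceZ ih

/-! ### `Z`-checks at a qubit -/

/-- Edges exist only as sides of squares, so the step is extended backwards to an `X`-check. -/
theorem At.qz {f : T.F} {r u : Coord} {q : (replaceZ m T).Q} {z : (replaceZ m T).Z}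
    (hq : At f false r q.1) (hz : At f false u z.1) (h : Step m r u) :
    (replaceZ m T).QZ q z := by
  have hpar := (hq.odds h.1).symm.trans q.2
  obtain ⟨p, hp⟩ := h.1.exists_step_to hpar.le
  have := hp.parity
  obtain ⟨x, hx⟩ := exists_at f false hp.1
  obtain ⟨F, s, -, hq', hz'⟩ := At.exists_square (x := ⟨x, (hx.odds hp.1).trans (by omega)⟩)
    hx hq hz hp h
  exact ⟨F, s, hq', hz'⟩

/-- A qubit of `Y_z` sees all its `Z`-checks in any square that contains it. Qubits of `Y_q` do not,
and `ho` excludes them. -/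
theorem TannerComplex.QZ.exists_step_in {f : T.F} {r : Coord} {q : (replaceZ m T).Q} {z : (replaceZ m T).Z}
    {z₀ : T.Z} (h : (replaceZ m T).QZ q z) (hq : At f false r q.1) (hr : r.Valid m)
    (ho : q.1.owner = .inr (.inr z₀)) : ∃ u, Step m r u ∧ At f false u z.1 := by
  obtain ⟨f₂, r₂, u₂, hr₂, hu₂, h₂⟩ := QZ.exists_step h
  obtain ⟨rfl, rfl, -⟩ | ⟨t₁, t₂, k, j, c, hq', rfl, rfl, hc⟩ := hq.compare hr₂ hr h₂.1 q.2
  · exact ⟨u₂, h₂, hu₂⟩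
  have g₂ := h₂.orient t₂
  have hu := hu₂.ofFalse t₂
  rw [Coord.orient_orient] at g₂
  rcases hc with ⟨hz, -, hk, hk', rfl⟩ | ⟨h, hk, rfl⟩ | ⟨hx, h, hk, hj, hj'⟩
  · have hb := g₂.of_onZQ
    generalize u₂.orient t₂ = u at *
    obtain ⟨a, b, d⟩ := u
    obtain rfl : b = 0 := hb
    exact ⟨_, g₂.orient t₁, (hu.onZQ_congr hz.symm hq'.symm).toFalse⟩
  · simp [ho] at h
  · simp [ho] at h

/-- Coordinates of a qubit of `Y_z`. -/
theorem HasProductLinks.exists_coord_of_owner (hT : HasProductLinks T) {q : (replaceZ m T).Q}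
    {z : T.Z} (ho : q.1.owner = .inr (.inr z)) :
    ∃ f r, Coord.Valid m r ∧ At f false r q.1 ∧ T.zOf f = z ∧ r.a ≤ 2 * m ∧ r.b ≤ 2 * m := by
  obtain ⟨f, s, p, hp, h⟩ := hT.exists_coord q.1 fun q' hq' => by
    simp [Vertex.owner, hq', PlanePoint.owner] at ho
  refine ⟨f, p.orient s, hp.orient s, h.toFalse, ?_⟩
  obtain ⟨-, -, h', -, h₁, -, h₂⟩ | ⟨t₁, t₂, k, j, c, -, e, -, hc⟩ :=
    h.toFalse.compare h.toFalse (hp.orient s) (hp.orient s) q.2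
  · rw [ho] at h'
    exact ⟨(Sum.inr_injective (Sum.inr_injective h')).symm, h₁, h₂⟩
  · rcases hc with ⟨-, h', hk, hk', rfl⟩ | ⟨h', -⟩ | ⟨-, h', -⟩ <;> rw [ho] at h'
    · refine ⟨(Sum.inr_injective (Sum.inr_injective h')).symm, ?_⟩
      rw [e]
      cases t₁ <;> simp [Coord.orient, hk']
    · simp at h'
    · simp at h'

/-- The single odd coordinate can go up or down: an odd `a` or `b` is at most `ℓ - 2`, and height 1
has both layers as neighbours. -/
theorem Coord.Valid.exists_two_steps {r : Coord} (hr : r.Valid m)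
    (h : r.a % 2 + r.b % 2 + r.c % 2 = 1) (ha : r.a ≤ 2 * m) (hb : r.b ≤ 2 * m) :
    ∃ u₁ u₂ : Coord, u₁ ≠ u₂ ∧ (u₁.a ≤ 2 * m ∧ u₁.b ≤ 2 * m) ∧ (u₂.a ≤ 2 * m ∧ u₂.b ≤ 2 * m) ∧
      ∀ u, Step m r u ↔ u = u₁ ∨ u = u₂ := by
  obtain ⟨a, b, c⟩ := r
  obtain ⟨h₁, h₂, h₃, h₄⟩ := hr
  dsimp only at *
  have hm := m.pos
  have hmod : a % 2 = 1 ∧ b % 2 = 0 ∧ c ≠ 1 ∨ b % 2 = 1 ∧ a % 2 = 0 ∧ c ≠ 1 ∨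
    c = 1 ∧ a % 2 = 0 ∧ b % 2 = 0 := by omega
  rcases hmod with ⟨h₅, h₆, h₇⟩ | ⟨h₅, h₆, h₇⟩ | ⟨h₇, h₅, h₆⟩
  · refine ⟨⟨a - 1, b, c⟩, ⟨a + 1, b, c⟩, by simp, by dsimp only; omega,
      by dsimp only; omega, fun ⟨a', b', c'⟩ => ?_⟩
    simp only [Step, Coord.Valid, Coord.mk.injEq]
    omega
  · refine ⟨⟨a, b - 1, c⟩, ⟨a, b + 1, c⟩, by simp, by dsimp only; omega,
      by dsimp only; omega, fun ⟨a', b', c'⟩ => ?_⟩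
    simp only [Step, Coord.Valid, Coord.mk.injEq]
    omega
  · refine ⟨⟨a, b, c - 1⟩, ⟨a, b, c + 1⟩, by simp, ⟨ha, hb⟩, ⟨ha, hb⟩, fun ⟨a', b', c'⟩ => ?_⟩
    simp only [Step, Coord.Valid, Coord.mk.injEq]
    omega

/-- A qubit of `Y_z` is joined to two `Z`-checks, and both lie in `Y_z`. -/
theorem HasProductLinks.exists_pair_of_owner_z (hT : HasProductLinks T) {q : (replaceZ m T).Q}
    {z : T.Z} (ho : q.1.owner = .inr (.inr z)) : ∃ w₁ w₂ : (replaceZ m T).Z, w₁ ≠ w₂ ∧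
      w₁.1.owner = .inr (.inr z) ∧ w₂.1.owner = .inr (.inr z) ∧
      ∀ w, (replaceZ m T).QZ q w ↔ w = w₁ ∨ w = w₂ := by
  obtain ⟨f, r, hr, hq, rfl, ha, hb⟩ := hT.exists_coord_of_owner ho
  have hpar := (hq.odds hr).symm.trans q.2
  obtain ⟨u₁, u₂, hne, hu₁, hu₂, hu⟩ := hr.exists_two_steps hpar ha hb
  have s₁ := (hu u₁).2 (.inl rfl)
  have s₂ := (hu u₂).2 (.inr rfl)
  obtain ⟨w₁, h₁⟩ := exists_at f false s₁.2.1
  obtain ⟨w₂, h₂⟩ := exists_at f false s₂.2.1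
  have p₁ := s₁.parity
  have p₂ := s₂.parity
  refine ⟨⟨w₁, (h₁.odds s₁.2.1).trans (by omega)⟩, ⟨w₂, (h₂.odds s₂.2.1).trans (by omega)⟩,
    fun h => hne ?_, h₁.owner_z hu₁.1 hu₁.2, h₂.owner_z hu₂.1 hu₂.2, fun w => ⟨fun h => ?_, ?_⟩⟩
  · obtain rfl : w₁ = w₂ := congrArg Subtype.val h
    exact At.coord_unique (hT.q_ne f) h₁ h₂ s₁.2.1 s₂.2.1
  · obtain ⟨u, hs, hw⟩ := h.exists_step_in hq hr ho
    rcases (hu u).1 hs with rfl | rfl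
    · exact .inl (Subtype.ext (hw.eq h₁))
    · exact .inr (Subtype.ext (hw.eq h₂))
  · rintro (rfl | rfl)
    · exact hq.qz h₁ s₁
    · exact hq.qz h₂ s₂

/-- On the boundary `a = ℓ` the value `ℓ + 1` is missing, so one neighbour remains instead of two.
-/
theorem Step.of_onQX_from {k j c : ℕ} {u : Coord} (h : Step m ⟨k, j, c⟩ u)
    (hk : k = 2 * (m : ℕ) + 1) (h0 : u.a % 2 + u.b % 2 + u.c % 2 = 0) : u = ⟨2 * m, j, c⟩ := by
  have hm := m.pos
  simp only [Step, Coord.Valid] at h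
  ext <;> simp only <;> omega

theorem step_onQX {k j c : ℕ} (hv : Coord.Valid m ⟨k, j, c⟩) (hk : k = 2 * (m : ℕ) + 1) :
    Step m ⟨k, j, c⟩ ⟨2 * m, j, c⟩ := by
  obtain ⟨h₁, h₂, h₃, h₄⟩ := hv
  dsimp only at *
  exact ⟨⟨h₁, h₂, h₃, h₄⟩, ⟨by dsimp only; omega, h₂, h₃, fun _ => .inl rfl⟩,
    .inl ⟨by dsimp only; omega, .inr hk.symm, rfl, rfl⟩⟩

/-- The `Z`-checks at a qubit of `Y_q` lie in the complexes `Y_z` with `z` joined to `q`. -/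
theorem TannerComplex.QZ.of_owner_q {q : (replaceZ m T).Q} {w : (replaceZ m T).Z} {q₀ : T.Q} {z₀ : T.Z}
    (h : (replaceZ m T).QZ q w) (hq : q.1.owner = .inr (.inl q₀))
    (hw : w.1.owner = .inr (.inr z₀)) :
    ∃ f t, ∃ j c : ℕ, j ≤ 2 * m ∧ At f t ⟨2 * m + 1, j, c⟩ q.1 ∧ At f t ⟨2 * m, j, c⟩ w.1 ∧
      Coord.Valid m ⟨2 * m + 1, j, c⟩ ∧ T.qOf f t = q₀ ∧ T.zOf f = z₀ := by
  obtain ⟨f, r, u, hr, hu, h⟩ := QZ.exists_step h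
  have p₀ := (hu.odds h.2.1).symm.trans w.2
  obtain ⟨-, -, h', -⟩ | ⟨t, -, k, j, c, -, rfl, -, hc⟩ := hr.compare hr h.1 h.1 q.2
  · simp [hq] at h'
  have hk : k = 2 * m + 1 ∧ j ≤ 2 * m ∧ T.qOf f t = q₀ := by
    rcases hc with ⟨-, h', -⟩ | ⟨h', hk, rfl⟩ | ⟨-, h', hk, -, hj⟩ <;> rw [hq] at h'
    · simp at h'
    · exact ⟨hk, by omega, (Sum.inl_injective (Sum.inr_injective h')).symm⟩
    · exact ⟨hk, hj, (Sum.inl_injective (Sum.inr_injective h')).symm⟩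
  obtain ⟨rfl, hj, hq₀⟩ := hk
  have g := h.orient t
  have hr' := hr.ofFalse t
  have hu' := hu.ofFalse t
  rw [Coord.orient_orient] at g hr'
  rw [g.of_onQX_from rfl ((Coord.parity_orient t u).trans p₀)] at hu'
  exact ⟨f, t, j, c, hj, hr', hu', g.1, hq₀, Sum.inr_injective (Sum.inr_injective
    ((hu'.owner_z le_rfl hj).symm.trans hw))⟩

theorem Coord.orient_onQX_injective {t t' : Bool} {j j' c c' : ℕ}
    (h : Coord.orient t ⟨2 * (m : ℕ) + 1, j, c⟩ = Coord.orient t' ⟨2 * m + 1, j', c'⟩)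
    (hj : j ≤ 2 * m) (hj' : j' ≤ 2 * m) : j = j' ∧ c = c' := by
  cases t <;> cases t' <;> simp [Coord.orient] at h <;> omega

/-- A qubit of `Y_q` is joined to exactly one `Z`-check of `Y_z` if `z` is joined to `q`. -/
theorem HasProductLinks.existsUnique_of_owner_q (hT : HasProductLinks T) {q : (replaceZ m T).Q}
    {q₀ : T.Q} {z₀ : T.Z} (hq : q.1.owner = .inr (.inl q₀)) (h : T.QZ q₀ z₀) :
    ∃! w : (replaceZ m T).Z, (replaceZ m T).QZ q w ∧ w.1.owner = .inr (.inr z₀) := by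
  have hm := m.pos
  -- Choose a square through the qubit that has `z₀` as its corner: at `q` it comes from the edge
  -- `q₀ z₀`, on an edge `qx` from the product link.
  obtain ⟨f, t, j, c, hj, hv, hf, rfl, rfl⟩ : ∃ f t, ∃ j c : ℕ, j ≤ 2 * m ∧
      Coord.Valid m ⟨2 * m + 1, j, c⟩ ∧ At f t ⟨2 * m + 1, j, c⟩ q.1 ∧
      T.qOf f t = q₀ ∧ T.zOf f = z₀ := by
    obtain ⟨⟨⟨P, c⟩, hv⟩, hodd⟩ := q
    have hv' : (c : ℕ) = 1 → P.OnStrip := fun h => hv (Fin.ext h)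
    have hc : (c : ℕ) ≤ 2 := by omega
    rcases P with z | ⟨z, q, _, k⟩ | q | ⟨q, x, hx, ⟨k, h0, hk⟩⟩ | x | ⟨f, a, b⟩ <;>
      simp only [Vertex.owner, PlanePoint.owner, reduceCtorEq, Sum.inr.injEq, Sum.inl.injEq] at hq
    · subst hq
      obtain ⟨f, t, rfl, rfl⟩ := h
      simp only [PlanePoint.OnStrip, imp_false] at hv'
      refine ⟨f, t, 0, c, by omega, by simp only [Coord.Valid]; omega, ⟨?_, rfl⟩, rfl, rfl⟩
      cases t <;> simp [Coord.orient, pt]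
    · subst hq
      obtain ⟨f, t, rfl, rfl, rfl⟩ := hT.exists_square _ _ _ hx h
      simp only [PlanePoint.OnStrip] at hv'
      refine ⟨f, t, k, c, by omega, by simp only [Coord.Valid]; omega, ⟨?_, rfl⟩, rfl, rfl⟩
      cases t <;> simp [Coord.orient, pt, h0, hk]
  have hs := step_onQX hv rfl
  have hpar := hs.parity
  have hpar' := (hf.odds hv).symm.trans q.2
  obtain ⟨w, hw⟩ := exists_at f t hs.2.1
  refine ⟨⟨w, (hw.odds hs.2.1).trans (by omega)⟩,
    ⟨hf.toFalse.qz hw.toFalse (hs.orient t), hw.owner_z le_rfl hj⟩, ?_⟩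
  rintro w' ⟨hqw, ho⟩
  obtain ⟨f', t', j', c', hj', hf', hw', hv', hq', hz'⟩ := hqw.of_owner_q hq ho
  refine Subtype.ext (At.eq (f := f) (s := t) (p := ⟨2 * m, j, c⟩) ?_ hw)
  -- A second such `Z`-check is seen in a square with the same `q₀` and `z₀`: at the corner `q` both
  -- squares share the edge `zq`, and elsewhere they also share `x` and so coincide.
  obtain ⟨-, -, h', -⟩ | ⟨t₁, t₂, k, i, d, -, e₁, e₂, hc⟩ :=
    hf.toFalse.compare hf'.toFalse (hv.orient t) (hv'.orient t') q.2
  · simp [hq] at h'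
  rcases hc with ⟨-, h', -⟩ | ⟨h', rfl, rfl⟩ | ⟨hx, h', rfl, -, hi⟩
  · simp [hq] at h'
  · obtain ⟨rfl, rfl⟩ := Coord.orient_onQX_injective e₁ hj (Nat.zero_le _)
    obtain ⟨rfl, rfl⟩ := Coord.orient_onQX_injective e₂ hj' (Nat.zero_le _)
    exact hw'.onZQ_congr hz' hq'
  · obtain ⟨rfl, rfl⟩ := Coord.orient_onQX_injective e₁ hj hi
    obtain ⟨rfl, rfl⟩ := Coord.orient_onQX_injective e₂ hj' hi
    obtain ⟨rfl, rfl⟩ := hT.square_unique f f' t t' hx hq'.symm hz'.symm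
    exact hw'

/-! ### Sums over the local complexes -/

open Classical in
/-- The sum of a `2`-cochain over each `Y_z`. -/
def sumZ (m : ℕ+) (T : TannerComplex) : (replaceZ m T).C2 →ₗ[F2] T.C2 :=
  (Matrix.of fun (z : T.Z) w => if ownZ m T w = .inr (.inr z) then (1 : F2) else 0).mulVecLin

open Classical in
/-- The sum of a `1`-cochain over each `Y_q`. -/
def sumQ (m : ℕ+) (T : TannerComplex) : (replaceZ m T).C1 →ₗ[F2] T.C1 :=
  (Matrix.of fun (q : T.Q) u => if ownQ m T u = .inr (.inl q) then (1 : F2) else 0).mulVecLin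

theorem sumZ_apply (σ : (replaceZ m T).C2) (z : T.Z) :
    sumZ m T σ z = ∑ w, restr2 m T (.inr (.inr z)) σ w := by
  simp [sumZ, Matrix.mulVec, dotProduct, restr2]

theorem exists_ownZ (w : (replaceZ m T).Z) : ∃ z, ownZ m T w = .inr (.inr z) := by
  obtain ⟨⟨⟨P, c⟩, hv⟩, hodd⟩ := w
  rcases P with z | ⟨z, q, _, k⟩ | q | ⟨q, x, hx, k⟩ | x | ⟨f, a, b⟩
  -- Points over `q`, over an edge `qx` and over `x` have an odd coordinate. Each closed goal brings
  -- the next to third place.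
  on_goal 3 => simp [Vertex.odds, PlanePoint.odds] at hodd
  on_goal 3 => simp [Vertex.odds, PlanePoint.odds] at hodd
  on_goal 3 => simp [Vertex.odds, PlanePoint.odds] at hodd
  all_goals exact ⟨_, rfl⟩

theorem ownQ_ne_inl (q : (replaceZ m T).Q) (x : T.X) : ownQ m T q ≠ .inl x := by
  obtain ⟨⟨⟨P, c⟩, hv⟩, hodd⟩ := q
  intro h
  rcases P with z | ⟨z, q, _, k⟩ | q | ⟨q, x, hx, k⟩ | x | ⟨f, a, b⟩ <;>
    simp [ownQ, Vertex.owner, PlanePoint.owner] at h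
  simp [Vertex.odds, PlanePoint.odds] at hodd
  omega

/-- Entry by entry this counts modulo 2 the `Z`-checks of `Y_z` at a qubit: one or none for a qubit
of `Y_q`, according to adjacency in `T`, and two or none for a qubit of some `Y_z₁`. -/
theorem HasProductLinks.sumZ_comp_δ1 (hT : HasProductLinks T) :
    sumZ m T ∘ₗ (replaceZ m T).δ1 = T.δ1 ∘ₗ sumQ m T := by
  classical
  rw [sumZ, sumQ, TannerComplex.δ1, TannerComplex.δ1, ← Matrix.mulVecLin_mul,
    ← Matrix.mulVecLin_mul]
  congr 1
  ext z q
  simp only [Matrix.mul_apply, Matrix.of_apply, mat1, mul_ite, mul_one, mul_zero,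
    ← ite_and]
  rcases hq : ownQ m T q with x | q₀ | z₁
  · exact absurd hq (ownQ_ne_inl q x)
  · rw [Finset.sum_eq_single q₀ (fun q' _ h => by simp [h.symm]) (by simp)]
    by_cases h : T.QZ q₀ z
    · obtain ⟨w, ⟨hw, hw'⟩, huniq⟩ := hT.existsUnique_of_owner_q hq h
      rw [Finset.sum_eq_single w (fun w' _ h' => if_neg fun h'' : _ ∧ ownZ m T w' = _ => h' (huniq w' ⟨h''.1, h''.2⟩))
        (by simp)]
      rw [if_pos ⟨hw, hw'⟩, if_pos ⟨rfl, h⟩]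
    · rw [if_neg fun h' => h h'.2]
      refine Finset.sum_eq_zero fun w _ => if_neg fun hw => h ?_
      obtain ⟨f, t, j, c, -, -, -, -, rfl, rfl⟩ := QZ.of_owner_q hw.1 hq hw.2
      exact T.qz_self f t
  · obtain ⟨w₁, w₂, hne, h₁, h₂, hw⟩ := hT.exists_pair_of_owner_z hq
    rw [Finset.sum_eq_zero (s := Finset.univ (α := T.Q)) (fun q' _ => if_neg (by simp))]
    by_cases hz : z₁ = z
    · subst hz
      rw [Finset.sum_eq_add w₁ w₂ hne
        (fun w _ h => if_neg fun h' => by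
          rcases (hw w).1 h'.1 with rfl | rfl
          exacts [h.1 rfl, h.2 rfl]) (by simp) (by simp),
        if_pos ⟨(hw w₁).2 (.inl rfl), h₁⟩, if_pos ⟨(hw w₂).2 (.inr rfl), h₂⟩]
      exact CharTwo.add_self_eq_zero 1
    · refine Finset.sum_eq_zero fun w _ => if_neg fun h => hz ?_
      rcases (hw w).1 h.1 with rfl | rfl
      · exact Sum.inr_injective (Sum.inr_injective (h₁.symm.trans h.2))
      · exact Sum.inr_injective (Sum.inr_injective (h₂.symm.trans h.2))

theorem HasProductLinks.sumZ_mem_B2 (hT : HasProductLinks T) (σ : (replaceZ m T).B2) :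
    sumZ m T σ ∈ T.B2 := by
  obtain ⟨e, he⟩ := σ.2
  refine ⟨sumQ m T e, ?_⟩
  rw [← he]
  exact (LinearMap.congr_fun hT.sumZ_comp_δ1 e).symm

/-- A nonzero sum over `Y_z` needs a nonzero summand, and each `Z`-check belongs to one piece only.
-/
theorem hammingNorm_sumZ_le (σ : (replaceZ m T).C2) :
    hammingNorm (sumZ m T σ) ≤ hammingNorm σ := by
  classical
  choose own hown using exists_ownZ (m := m) (T := T)
  refine Finset.card_le_card_of_surjOn own fun z hz => ?_
  simp only [Finset.coe_filter, Finset.mem_univ, true_and, Set.mem_ofPred_eq, sumZ_apply] at hz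
  obtain ⟨w, -, hw⟩ := Finset.exists_ne_zero_of_sum_ne_zero hz
  rw [restr2] at hw
  split_ifs at hw with h
  · exact ⟨w, by simpa using hw,
      Sum.inr_injective (Sum.inr_injective ((hown w).symm.trans h))⟩
  · exact absurd rfl hw

/-! ### Connectedness of the local complexes -/

theorem δloc1_apply (e : (replaceZ m T).C1) (w : (replaceZ m T).Z) {v : T.V}
    (hw : ownZ m T w = v) :
    δloc1 m T e w = locδ1 m T v (fun u => e u.1) ⟨w, hw⟩ := by
  classical
  subst hw
  simp only [δloc1, locδ1, Matrix.mulVecLin_apply, Matrix.mulVec, dotProduct, Matrix.of_apply,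
    Matrix.submatrix_apply, ite_mul, zero_mul]
  rw [← Finset.sum_filter]
  exact Finset.sum_subtype (p := fun u => ownQ m T u = ownZ m T w) _ (by simp)
    fun u => (replaceZ m T).mat1 w u * e u

theorem cochain_add_self {ι : Type*} (x : ι → F2) : x + x = 0 :=
  funext fun i => CharTwo.add_self_eq_zero (x i)

open Classical in
/-- Two `Z`-checks represent the same local cohomology class. -/
def Homologous (w w' : (replaceZ m T).Z) : Prop :=
  (Pi.single w 1 + Pi.single w' 1 : (replaceZ m T).C2) ∈ LinearMap.range (δloc1 m T)

theorem Homologous.refl (w : (replaceZ m T).Z) : Homologous w w := by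
  rw [Homologous, cochain_add_self]
  exact Submodule.zero_mem _

theorem Homologous.trans {w₁ w₂ w₃ : (replaceZ m T).Z} (h : Homologous w₁ w₂)
    (h' : Homologous w₂ w₃) : Homologous w₁ w₃ := by
  classical
  have := Submodule.add_mem _ h h'
  rwa [add_assoc, ← add_assoc (Pi.single w₂ 1), cochain_add_self, zero_add] at this

/-- The local coboundary of the qubit is the sum of its two ends. -/
theorem HasProductLinks.homologous_of_qz (hT : HasProductLinks T) {q : (replaceZ m T).Q}
    {w w' : (replaceZ m T).Z} {z : T.Z} (hq : q.1.owner = .inr (.inr z))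
    (h : (replaceZ m T).QZ q w) (h' : (replaceZ m T).QZ q w') : Homologous w w' := by
  classical
  by_cases hne : w = w'
  · exact hne ▸ .refl w
  obtain ⟨w₁, w₂, -, h₁, h₂, hw⟩ := hT.exists_pair_of_owner_z hq
  have hw' : ∀ y, (replaceZ m T).QZ q y ↔ y = w ∨ y = w' := by
    intro y
    have i := (hw w).1 h
    have i' := (hw w').1 h'
    rw [hw y]
    grind
  have ho : ∀ y, (replaceZ m T).QZ q y → ownQ m T q = ownZ m T y := by
    intro y hy
    rcases (hw y).1 hy with rfl | rfl
    · exact hq.trans h₁.symm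
    · exact hq.trans h₂.symm
  refine ⟨Pi.single q 1, funext fun y => ?_⟩
  rw [δloc1, Matrix.mulVecLin_apply, Matrix.mulVec_single_one, Matrix.col_apply, Matrix.of_apply,
    mat1, Matrix.of_apply, Pi.add_apply, Pi.single_apply, Pi.single_apply]
  by_cases hy : (replaceZ m T).QZ q y
  · rw [if_pos (ho y hy), if_pos hy]
    rcases (hw' y).1 hy with rfl | rfl
    · simp [hne]
    · simp [Ne.symm hne]
  · have := mt (hw' y).2 hy
    push Not at this
    simp [hy, this.1, this.2]

theorem exists_z_at (f : T.F) {u : Coord} (hu : u.Valid m)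
    (h : u.a % 2 + u.b % 2 + u.c % 2 = 0) : ∃ w : (replaceZ m T).Z, At f false u w.1 := by
  obtain ⟨w, hw⟩ := exists_at f false hu
  exact ⟨⟨w, (hw.odds hu).trans h⟩, hw⟩

/-- `Z`-checks on both sides of a qubit of `Y_z` represent the same class. -/
theorem HasProductLinks.homologous_of_step (hT : HasProductLinks T) {f : T.F} {r u u' : Coord}
    {w w' : (replaceZ m T).Z} (hu : Step m r u) (hu' : Step m r u') (ha : r.a ≤ 2 * m)
    (hb : r.b ≤ 2 * m) (h : At f false u w.1) (h' : At f false u' w'.1) : Homologous w w' := by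
  obtain ⟨q, hq⟩ := exists_at f false hu.1
  have hpar := hu.parity
  have hw := (h.odds hu.2.1).symm.trans w.2
  have hodd := (hq.odds hu.1).trans (hpar.trans (by omega : _ = 1))
  exact hT.homologous_of_qz (q := ⟨q, hodd⟩) (hq.owner_z ha hb) (At.qz hq h hu) (At.qz hq h' hu')

theorem step_a_succ {k b c : ℕ} (hk : k + 1 ≤ m) (hb : b ≤ 2 * m) (hc : c = 0 ∨ c = 2) :
    Step m ⟨2 * k + 1, b, c⟩ ⟨2 * k, b, c⟩ ∧ Step m ⟨2 * k + 1, b, c⟩ ⟨2 * (k + 1), b, c⟩ := by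
  rcases hc with rfl | rfl <;> simp [Step, Coord.Valid] <;> omega

theorem step_b_succ {a k c : ℕ} (ha : a ≤ 2 * m) (hk : k + 1 ≤ m) (hc : c = 0 ∨ c = 2) :
    Step m ⟨a, 2 * k + 1, c⟩ ⟨a, 2 * k, c⟩ ∧ Step m ⟨a, 2 * k + 1, c⟩ ⟨a, 2 * (k + 1), c⟩ := by
  rcases hc with rfl | rfl <;> simp [Step, Coord.Valid] <;> omega

/-- Every `Z`-check of `Y_z` represents the class of `z`. -/
theorem HasProductLinks.homologous_of_ownZ (hT : HasProductLinks T) {w w₀ : (replaceZ m T).Z}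
    {z : T.Z} (hw : ownZ m T w = .inr (.inr z)) (h₀ : w₀.1.1 = (.atZ z, 0)) :
    Homologous w w₀ := by
  have hm := m.pos
  obtain ⟨f, s, p', hp', hz'⟩ := hT.exists_coord w.1 fun q hq => by
    simp [ownZ, Vertex.owner, hq, PlanePoint.owner] at hw
  have hp := hp'.orient s
  have hz := hz'.toFalse
  generalize p'.orient s = p at *
  have hpar := (hz.odds hp).symm.trans w.2
  -- All coordinates of a `Z`-check are even, while `ℓ` is odd.
  have ha : p.a ≤ 2 * m := by have := hp.1; omega
  have hb : p.b ≤ 2 * m := by have := hp.2.1; omega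
  obtain rfl : T.zOf f = z :=
    Sum.inr_injective (Sum.inr_injective ((hz.owner_z ha hb).symm.trans hw))
  have hw₀ : At f false ⟨0, 0, 0⟩ w₀.1 := by
    rw [At, h₀]
    simp [Coord.orient, pt]
  -- One move across a qubit; the path from `z` runs along `b = 0`, through the strip if necessary,
  -- and then in the direction of `b`.
  have move : ∀ {r u u' : Coord}, Step m r u → Step m r u' → r.a ≤ 2 * m → r.b ≤ 2 * m →
      u.a % 2 + u.b % 2 + u.c % 2 = 0 →
      (∃ y : (replaceZ m T).Z, At f false u y.1 ∧ Homologous y w₀) →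
      ∃ y : (replaceZ m T).Z, At f false u' y.1 ∧ Homologous y w₀ := by
    rintro r u u' hu hu' ha hb h0 ⟨y, hy, hy'⟩
    have := hu.parity
    have := hu'.parity
    obtain ⟨y', h⟩ := exists_z_at f hu'.2.1 (by omega)
    exact ⟨y', h, (hT.homologous_of_step hu' hu ha hb h hy).trans hy'⟩
  have bottom : ∀ k, k ≤ (m : ℕ) →
      ∃ y : (replaceZ m T).Z, At f false ⟨2 * k, 0, 0⟩ y.1 ∧ Homologous y w₀ := by
    intro k
    induction k with
    | zero => exact fun _ => ⟨w₀, hw₀, .refl w₀⟩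
    | succ k ih =>
      intro hk
      obtain ⟨h₁, h₂⟩ := step_a_succ hk (Nat.zero_le _) (b := 0) (.inl (Eq.refl 0))
      exact move h₁ h₂ (by dsimp only; omega) (Nat.zero_le _) (by dsimp only; omega) (ih (by omega))
  -- The top layer is entered through the strip at `a = ℓ - 1`, so the walk along `b = 0` goes back
  -- from there.
  have top : ∀ k, k ≤ (m : ℕ) →
      ∃ y : (replaceZ m T).Z, At f false ⟨2 * (m - k), 0, 2⟩ y.1 ∧ Homologous y w₀ := by
    intro k
    induction k with
    | zero =>
      have h₁ : Step m ⟨2 * m, 0, 1⟩ ⟨2 * m, 0, 0⟩ := by simp [Step, Coord.Valid]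
      have h₂ : Step m ⟨2 * m, 0, 1⟩ ⟨2 * m, 0, 2⟩ := by simp [Step, Coord.Valid]
      exact fun _ => move h₁ h₂ le_rfl (Nat.zero_le _) (by simp) (bottom m le_rfl)
    | succ k ih =>
      intro hk
      obtain ⟨h₁, h₂⟩ := step_a_succ (m := m) (k := m - (k + 1)) (by omega) (Nat.zero_le _)
        (b := 0) (.inr (Eq.refl 2))
      rw [show (m : ℕ) - (k + 1) + 1 = m - k by omega] at h₂
      exact move h₂ h₁ (by dsimp only; omega) (Nat.zero_le _) (by dsimp only; omega) (ih (by omega))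
  have all : ∀ k l c, k ≤ (m : ℕ) → l ≤ (m : ℕ) → c = 0 ∨ c = 2 →
      ∃ y : (replaceZ m T).Z, At f false ⟨2 * k, 2 * l, c⟩ y.1 ∧ Homologous y w₀ := by
    intro k l c hk hl hc
    induction l with
    | zero =>
      rcases hc with rfl | rfl
      · exact bottom k hk
      · have := top (m - k) (by omega)
        rwa [show (m : ℕ) - (m - k) = k by omega] at this
    | succ l ih =>
      obtain ⟨h₁, h₂⟩ := step_b_succ (a := 2 * k) (by omega) hl hc
      exact move h₁ h₂ (by dsimp only; omega) (by dsimp only; omega) (by dsimp only; omega)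
        (ih (by omega))
  obtain ⟨y, hy, hy'⟩ := all (p.a / 2) (p.b / 2) p.c (by omega) (by omega)
    (by have := hp.2.2.1; omega)
  rw [show 2 * (p.a / 2) = p.a by omega, show 2 * (p.b / 2) = p.b by omega] at hy
  rwa [Subtype.ext (hz.eq hy)]

/-- By linearity it suffices to take one `Z`-check `w` of some `Y_z`; then `base2 (sumZ w)` is the
copy of `z` at height 0, homologous to `w`. -/
theorem HasProductLinks.add_base2_sumZ_mem (hT : HasProductLinks T) (σ : (replaceZ m T).C2) :
    σ + base2 m T (sumZ m T σ) ∈ LinearMap.range (δloc1 m T) := by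
  classical
  let L : (replaceZ m T).C2 →ₗ[F2] (replaceZ m T).C2 :=
    LinearMap.id + base2 m T ∘ₗ sumZ m T
  have key : ∀ w, L (Pi.single w 1) ∈ LinearMap.range (δloc1 m T) := by
    intro w
    obtain ⟨z, hz⟩ := exists_ownZ w
    let w₀ : (replaceZ m T).Z := ⟨⟨(.atZ z, 0), by simp⟩, by simp [Vertex.odds, PlanePoint.odds]⟩
    have h := hT.homologous_of_ownZ hz (w₀ := w₀) rfl
    have hs : sumZ m T (Pi.single w 1) = Pi.single z 1 := by
      funext z'
      simp [sumZ, Matrix.col_apply, hz, Pi.single_apply, eq_comm]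
    have hb : base2 m T (Pi.single z 1) = Pi.single w₀ 1 := by
      funext w'
      rw [base2, Matrix.mulVecLin_apply, Matrix.mulVec_single_one, Matrix.col_apply,
        Matrix.of_apply, Pi.single_apply]
      refine if_congr ⟨fun h => Subtype.ext (Subtype.ext h), ?_⟩ rfl rfl
      rintro rfl
      rfl
    rw [show L _ = _ from LinearMap.add_apply _ _ _, LinearMap.comp_apply, hs, hb, LinearMap.id_apply]
    rw [Homologous] at h
    convert h
  have h := LinearMap.pi_apply_eq_sum_univ L σ
  change L σ ∈ _
  rw [h]
  refine Submodule.sum_mem _ fun w _ => Submodule.smul_mem _ _ ?_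
  convert key w using 2
  funext j
  simp [Pi.single_apply, eq_comm]

/-! ### The local homotopy in degree two -/

theorem restr2_apply_of_own (v : T.V) (σ : (replaceZ m T).C2) (w : (replaceZ m T).Z)
    (hw : ownZ m T w = v) : restr2 m T v σ w = σ w := by
  rw [restr2, if_pos hw]

/-- Every vertex has directed distance 0 to itself. -/
theorem xi_apply_of_own (k : ℕ∞) (v : T.V) (σ : (replaceZ m T).C2) (w : (replaceZ m T).Z)
    (hw : ownZ m T w = v) : xi m T k v σ w = σ w := by
  classical
  have h0 : T.dirDist v v ≤ k := by
    refine (iInf₂_le 0 (TannerComplex.DiPath.nil v)).trans ?_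
    simp
  rw [xi, Finset.sum_apply, Finset.sum_eq_single v]
  · exact restr2_apply_of_own v σ w hw
  · intro v' _ hne
    rw [restr2, if_neg fun h => hne (h.symm.trans hw)]
  · intro h
    simp [h0] at h

namespace LocalContraction

variable (h : LocalContraction m T)

theorem H2_apply (σ : (replaceZ m T).C2) (u : (replaceZ m T).Q) {v : T.V}
    (hu : ownQ m T u = v) : h.H2 σ u = h.h2 v (fun w => σ w.1) ⟨u, hu⟩ := by
  subst hu
  rfl

theorem H2_congr {σ τ : (replaceZ m T).C2} {v : T.V} (hστ : ∀ w, ownZ m T w = v → σ w = τ w)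
    (u : (replaceZ m T).Q) (hu : ownQ m T u = v) : h.H2 σ u = h.H2 τ u := by
  rw [h.H2_apply σ u hu, h.H2_apply τ u hu]
  exact congrFun (congrArg (h.h2 v) (funext fun w => hστ w.1 w.2)) _

theorem δloc1_H2_δloc1 (e : (replaceZ m T).C1) :
    δloc1 m T (h.H2 (δloc1 m T e)) = δloc1 m T e := by
  funext w
  rw [δloc1_apply _ w rfl, δloc1_apply e w rfl]
  have h₁ : (fun u : {u // ownQ m T u = ownZ m T w} => h.H2 (δloc1 m T e) u.1) =
      h.h2 _ (locδ1 m T _ fun u => e u.1) := by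
    funext u
    rw [h.H2_apply _ u.1 u.2]
    exact congrFun (congrArg (h.h2 _) (funext fun y => δloc1_apply e y.1 y.2)) _
  rw [h₁]
  exact congrFun (LinearMap.congr_fun (h.dhd1 (ownZ m T w)) fun u => e u.1) ⟨w, rfl⟩

/-- Only the pieces `Y_z` contain `Z`-checks, so elsewhere the local homotopy starts from the zero
space. -/
theorem H2_eq_zero (σ : (replaceZ m T).C2) (u : (replaceZ m T).Q)
    (hu : ∀ z, ownQ m T u ≠ .inr (.inr z)) : h.H2 σ u = 0 := by
  rw [h.H2_congr (τ := 0) (fun w hw => ?_) u rfl, map_zero, Pi.zero_apply]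
  obtain ⟨z, hz⟩ := exists_ownZ w
  exact absurd (hw.symm.trans hz) (hu z)

/-- The connecting map vanishes on the image of `h`, since qubits of `Y_z` have no `Z`-checks
outside `Y_z`. -/
theorem δ1_H2 (hT : HasProductLinks T) (σ : (replaceZ m T).C2) :
    (replaceZ m T).δ1 (h.H2 σ) = δloc1 m T (h.H2 σ) := by
  classical
  funext w
  simp only [TannerComplex.δ1, δloc1, Matrix.mulVecLin_apply, Matrix.mulVec, dotProduct,
    Matrix.of_apply]
  refine Finset.sum_congr rfl fun u _ => ?_
  by_cases hu : ∃ z, ownQ m T u = .inr (.inr z)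
  · obtain ⟨z, hz⟩ := hu
    split_ifs with hne
    · rfl
    · rw [mat1, Matrix.of_apply, if_neg]
      intro hw
      obtain ⟨w₁, w₂, -, h₁, h₂, hall⟩ := hT.exists_pair_of_owner_z hz
      rcases (hall w).1 hw with rfl | rfl
      · exact hne (hz.trans h₁.symm)
      · exact hne (hz.trans h₂.symm)
  · rw [h.H2_eq_zero σ u fun z hz => hu ⟨z, hz⟩, mul_zero, mul_zero]

/-- The error of the correction `h σ` is the image of the sums of `σ` over the local complexes. -/
theorem eq_δ1_H2_add (hT : HasProductLinks T) (σ : (replaceZ m T).C2) :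
    σ = (replaceZ m T).δ1 (h.H2 σ) + h.F_RZ2 (sumZ m T σ) := by
  obtain ⟨e, he⟩ := hT.add_base2_sumZ_mem σ
  have hF : h.F_RZ2 (sumZ m T σ) = base2 m T (sumZ m T σ) +
      δloc1 m T (h.H2 (base2 m T (sumZ m T σ))) := rfl
  have hb : base2 m T (sumZ m T σ) = σ + δloc1 m T e := by
    rw [he, ← add_assoc, cochain_add_self, zero_add]
  rw [h.δ1_H2 hT, hF, hb, map_add, map_add, h.δloc1_H2_δloc1]
  -- After substituting `base2 σ' = σ + δ_loc e`, the terms `δ_loc h σ` and `δ_loc e` each occur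
  -- twice.
  calc σ = σ + ((δloc1 m T (h.H2 σ) + δloc1 m T (h.H2 σ)) + (δloc1 m T e + δloc1 m T e)) := by
        rw [cochain_add_self, cochain_add_self, add_zero, add_zero]
    _ = _ := by abel

theorem locallyComputable (hT : HasProductLinks T) :
    LocallyComputable m T (fun σ => ⟨sumZ m T σ, hT.sumZ_mem_B2 σ⟩) (fun σ => h.H2 σ) where
  correction := by
    classical
    have hφ : ∀ (σ : (replaceZ m T).C2) v,
        restr1 m T v (h.H2 (xi m T 1 v σ)) = restr1 m T v (h.H2 σ) := by
      intro σ v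
      funext u
      rw [restr1, restr1]
      split_ifs with hu
      · exact h.H2_congr (fun w hw => xi_apply_of_own 1 v σ w hw) u hu
      · rfl
    -- Restricting to `Y_v` discards the values of `h` on the other pieces, where `τ` need not agree
    -- with `σ`.
    refine ⟨fun v τ => restr1 m T v (h.H2 τ), fun σ => ⟨?_, fun v => (hφ σ v).symm⟩⟩
    simp only [hφ]
    funext u
    rw [Finset.sum_apply]
    simp [restr1]
  syndrome := by
    refine ⟨fun z τ => sumZ m T τ z, fun σ z => ?_⟩
    simp only [sumZ_apply]
    refine Finset.sum_congr rfl fun w _ => ?_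
    rw [restr2, restr2]
    split_ifs with hw
    · exact (xi_apply_of_own 2 _ _ w hw).symm
    · rfl

end LocalContraction

end CoarseGraining

end

theorem mainTheorem5 (m : ℕ+) (i : ℕ) (hi : Odd i)
    (h : CoarseGraining.LocalContraction m (CoarseGraining.level m i)) :
    ∃ (σ' : (CoarseGraining.replaceZ m (CoarseGraining.level m i)).B2 →
          (CoarseGraining.level m i).B2)
      (f : (CoarseGraining.replaceZ m (CoarseGraining.level m i)).B2 →
          (CoarseGraining.replaceZ m (CoarseGraining.level m i)).C1),
      CoarseGraining.LocallyComputable m (CoarseGraining.level m i) σ' f ∧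
      ∀ σ : (CoarseGraining.replaceZ m (CoarseGraining.level m i)).B2,
        (σ : (CoarseGraining.replaceZ m (CoarseGraining.level m i)).C2) =
            (CoarseGraining.replaceZ m (CoarseGraining.level m i)).δ1 (f σ) +
              h.F_RZ2 (σ' σ : (CoarseGraining.level m i).C2) ∧
        hammingNorm (σ' σ : (CoarseGraining.level m i).C2) ≤
          hammingNorm (σ : (CoarseGraining.replaceZ m (CoarseGraining.level m i)).C2) ∧
        ∀ z : (CoarseGraining.level m i).Z,
          (σ' σ : (CoarseGraining.level m i).C2) z =
            ∑ u, CoarseGraining.restr2 m (CoarseGraining.level m i) (.inr (.inr z))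
              (σ : (CoarseGraining.replaceZ m (CoarseGraining.level m i)).C2) u := by
  have hT := CoarseGraining.hasProductLinks_level (m := m) i
  -- Both witnesses are read off from `locallyComputable`.
  exact ⟨_, _, h.locallyComputable hT, fun σ => ⟨h.eq_δ1_H2_add hT σ,
    CoarseGraining.hammingNorm_sumZ_le _, CoarseGraining.sumZ_apply _⟩⟩
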